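/- **Setting.** Let $\mathfrak M$ be the space of Hermitian $2\times2$ matrices with the quadratic form $-\det$, identified with Minkowski space $\mathbb R^{3,1}$ by $\Lambda(y)=\begin{pmatrix}y_0+y_1&y_2+iy_3\\y_2-iy_3&y_0-y_1\end{pmatrix}$, and let $\mathfrak G\subset\mathfrak M$ be the traceless matrices, so $\mathfrak{sl}_2(\mathbb C)=\mathfrak{su}(2)\oplus\mathfrak G$. Let $\widehat X$ be the transposed comatrix (adjugate) of $X$. Let $\mathbb H^3=\mathrm{SL}(2,\mathbb C)/\mathrm{SU}(2)$, embedded in $\mathfrak M$ by $[g]\mapsto gg^*$, be the totally geodesic hyperbolic slice of $\mathrm{AdS}^{3,1}$, with hyperbolic metric $b$. The restriction to $\mathbb H^3$ of the tangent bundle of AdS is $\mathrm{SL}(2,\mathbb C)\times_{\mathrm{SU}(2)}\mathfrak M$ (action $X\mapsto hXh^*$); the class $\{g,\zeta\}$ is tangent to $\mathbb H^3$ for $\zeta\in\mathfrak G$ (the velocity of $[g\exp(t\zeta)]$ at $t=0$), and $e_0=\{g,\tfrac12 I\}$ is the unit normal. The spinor bundle of AdS along $\mathbb H^3$ is $\Sigma=\mathrm{SL}(2,\mathbb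 C)\times_{\tilde\rho|\mathrm{SU}(2)}\mathbb C^4$, $\tilde\rho(g)=\mathrm{diag}(g,(g^*)^{-1})$, with Clifford action $\{g,X\}\cdot\{g,\psi\}=\{g,\Theta(X)\psi\}$, $\Theta(X)=\begin{pmatrix}0&2X\\2\widehat X&0\end{pmatrix}$, and with the scalar product $\langle\cdot,\cdot\rangle$ induced by the standard Hermitian product of $\mathbb C^4$. Let $D$ be the Levi-Civita connection of AdS along $\mathbb H^3$. The space $IKS(\Sigma)$ of $\beta$-imaginary Killing spinors consists of the smooth sections $\sigma$ of $\Sigma$ with $D_Y\sigma+\frac i2Y\cdot\sigma=0$ for all $Y$ tangent to $\mathbb H^3$. For $w,u\in\mathbb C^2$ and $z=(z_1,z_2)$ put $\sigma^{-1}_{w\otimes z}[g]=\{g,(z_1g^{-1}w,z_2g^{-1}w)\}$ and $\sigma^*_{u\otimes z}[g]=\{g,(z_1g^*u,z_2g^*u)\}$. The group $\mathrm{SL}(2,\mathbb C)$ acts on sections by $(e*\sigma)[g]=e*\sigma[e^{-1}g]$, where $e*\{g,\psi\}=\{eg,\psi\}$, and on $\mathbb C^2\oplus\mathbb C^2$ by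 $e*(w\oplus u)=ew\oplus(e^*)^{-1}u$. Let $N_b=\{f\in C^\infty(\mathbb H^3):\mathrm{Hess}_bf=fb\}$; $f\in N_b$ is called causal if it is the restriction to $\mathbb H^3$ of a linear form $\sum_ka_ky_k$ with $-a_0^2+a_1^2+a_2^2+a_3^2\le0$. A Killing form on $\mathbb H^3$ is a smooth 1-form $\alpha$ with $D\alpha$ skew-symmetric. **Proposition.** 1. $IKS(\Sigma)$ is the complex linear span of the sections $\sigma^{-1}_{w\otimes(1,-i)}$ and $\sigma^*_{u\otimes(1,i)}$, $w,u\in\mathbb C^2$. It has complex dimension 4, and $w\oplus u\mapsto\sigma_{w\oplus u}:=\sigma^{-1}_{w\otimes(1,-i)}+\sigma^*_{u\otimes(1,i)}$ is a linear isomorphism $\mathbb C^2\oplus\mathbb C^2\to IKS(\Sigma)$. 2. Let $\sigma=\sigma_{w\oplus u}$. The formula $V_{w\oplus u}(W)=2(w^*\widehat Ww+u^*Wu)$ defines a real linear form on $\mathfrak M$, and the function $V_\sigma:=\langle\sigma,\sigma\rangle$ satisfies $V_\sigma[g]=V_{w\oplus u}(gg^*)$ for all $g\in\mathrm{SL}(2,\mathbb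 C)$. Moreover $V_\sigma$ is a causal element of $N_b$. 3. For $\sigma=\sigma_{w\oplus u}$, $\alpha_\sigma(Y):=\langle Y\cdot e_0\cdot\sigma,\sigma\rangle$ is real and is a Killing form on $\mathbb H^3$. The formula $\alpha_{w\oplus u}(\xi)=2(w^*\xi u+u^*\xi^*w)$ defines a real-valued real-linear form on $\mathfrak{sl}_2(\mathbb C)$, related to $\alpha_\sigma$ as follows. For $\xi\in\mathfrak G$ let $X^\xi[g]=\{g,\frac12\xi\}$. Then $\alpha_\sigma(X^\xi)_{[g]}=\alpha_{w\oplus u}\big((g^*)^{-1}\xi g^*\big)$ for all $g$ and $\xi\in\mathfrak G$ (at $g=1$ this is $2(w^*\xi u+u^*\xi w)$), and at $g=1$, for $\eta,\xi\in\mathfrak G$, $$(D_{X^\eta}\alpha_\sigma)(X^\xi)=w^*(\xi\eta-\eta\xi)u-u^*(\xi\eta-\eta\xi)w=\tfrac12\,\alpha_{w\oplus u}(\xi\eta-\eta\xi).$$ 4. The map $\mathcal K:\mathbb C^2\oplus\mathbb C^2\to(\mathfrak M\oplus\mathfrak{sl}_2(\mathbb C))^{*\mathbb R}$, $w\oplus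 u\mapsto V_{w\oplus u}\oplus\alpha_{w\oplus u}$, is $\mathrm{SL}(2,\mathbb C)$-equivariant: for all $e\in\mathrm{SL}(2,\mathbb C)$ one has $e*\sigma_{w\oplus u}=\sigma_{e*(w\oplus u)}$ and $$\mathcal K_{e*(w\oplus u)}=\big(V_{w\oplus u}\circ\mu(e^{-1})\big)\oplus\big(\alpha_{w\oplus u}\circ\mathrm{Ad}(e^*)\big),\qquad\mu(g)W=gWg^*,\quad\mathrm{Ad}(g)\xi=g\xi g^{-1}.$$ -/

import Mathlib

open scoped Matrix ContDiff

noncomputable section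

namespace HypSpin

/-! ## Matrices, Minkowski space and groups -/

abbrev Mat2 := Matrix (Fin 2) (Fin 2) ℂ

abbrev C2 := Fin 2 → ℂ

/-- The fibre `ℂ⁴ = ℂ² ⊕ ℂ²` of the spinor bundle. -/
abbrev Spinor := C2 × C2

abbrev SL2 := Matrix.SpecialLinearGroup (Fin 2) ℂ

/-- `𝔰𝔩₂(ℂ)` as a real vector space. -/
def sl2 : Submodule ℝ Mat2 := LinearMap.ker (Matrix.traceLinearMap (Fin 2) ℝ ℂ)

/-- `𝔐`: the Hermitian `2 × 2` matrices; with `-det` it is Minkowski space `ℝ^{3,1}`. -/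
def herm2 : Submodule ℝ Mat2 := selfAdjoint.submodule ℝ Mat2

/-- `𝔊`: the traceless Hermitian matrices, so that `𝔰𝔩₂(ℂ) = 𝔰𝔲(2) ⊕ 𝔊`. -/
def hermTraceless : Submodule ℝ Mat2 := herm2 ⊓ sl2

/-- The symmetric bilinear form whose quadratic form is `-det` on Hermitian matrices. -/
def mink (X Y : Mat2) : ℝ := -((X + Y).det - X.det - Y.det).re / 2

/-- The isometry `Λ` from `(ℝ⁴, -dy₀² + dy₁² + dy₂² + dy₃²)` onto `𝔐`. -/
def lam (y : Fin 4 → ℝ) : Mat2 :=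
  !![(y 0 : ℂ) + y 1, (y 2 : ℂ) + Complex.I * y 3;
     (y 2 : ℂ) - Complex.I * y 3, (y 0 : ℂ) - y 1]

/-- The image under `Λ` of the canonical basis of `ℝ⁴`. -/
def basisMat (k : Fin 4) : Mat2 := lam (Pi.single k 1)

/-- `SU(2)`, the isotropy group of the base point of `ℍ³ = SL(2,ℂ)/SU(2)`. -/
def SU2 : Set SL2 := {h | (h : Mat2) ∈ Matrix.unitaryGroup (Fin 2) ℂ}

/-- The point `g g*` of the hyperboloid `ℍ³ ⊂ 𝔐` represented by `g ∈ SL(2,ℂ)`. -/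
def basePoint (g : SL2) : Mat2 := (g : Mat2) * (g : Mat2)ᴴ

theorem basePoint_mem (g : SL2) : basePoint g ∈ herm2 := by
  change star ((g : Mat2) * (g : Mat2)ᴴ) = _
  rw [Matrix.star_eq_conjTranspose, Matrix.conjTranspose_mul, Matrix.conjTranspose_conjTranspose]
  rfl

/-- The conjugate transpose `g*` as an element of `SL(2,ℂ)`. -/
def conjT (g : SL2) : SL2 :=
  ⟨(g : Mat2)ᴴ, by rw [Matrix.det_conjTranspose, g.2, star_one]⟩

/-- `μ(g) : X ↦ g X g*` on `𝔐`. -/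
def mu (g : SL2) : herm2 →ₗ[ℝ] herm2 where
  toFun X := ⟨(g : Mat2) * (X : Mat2) * (g : Mat2)ᴴ, by
    have hX : (X : Mat2)ᴴ = X := X.2
    change ((g : Mat2) * (X : Mat2) * (g : Mat2)ᴴ)ᴴ = _
    simp only [Matrix.conjTranspose_mul, Matrix.conjTranspose_conjTranspose, hX, Matrix.mul_assoc]⟩
  map_add' X Y := Subtype.ext (by simp [mul_add, add_mul])
  map_smul' c X := Subtype.ext (by simp)

/-- `Ad(g) : ξ ↦ g ξ g⁻¹` on `𝔰𝔩₂(ℂ)`. -/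
def adj (g : SL2) : sl2 →ₗ[ℝ] sl2 where
  toFun X := ⟨(g : Mat2) * (X : Mat2) * ((g⁻¹ : SL2) : Mat2), by
    have hX : (X : Mat2).trace = 0 := X.2
    change ((g : Mat2) * (X : Mat2) * ((g⁻¹ : SL2) : Mat2)).trace = 0
    rw [Matrix.trace_mul_comm, ← Matrix.mul_assoc, ← Matrix.SpecialLinearGroup.coe_mul,
      inv_mul_cancel, Matrix.SpecialLinearGroup.coe_one, Matrix.one_mul, hX]⟩
  map_add' X Y := Subtype.ext (by simp [mul_add, add_mul])
  map_smul' c X := Subtype.ext (by simp)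

theorem det_exp_of_trace_zero (A : Mat2) (hA : A.trace = 0) : (NormedSpace.exp A).det = 1 := by
  let J : Mat2 := !![0, 1; -1, 0]
  have hJ : IsUnit J := by
    rw [Matrix.isUnit_iff_isUnit_det]
    simp [J, Matrix.det_fin_two]
  have hadj : ∀ M : Mat2, M.adjugate = J * Mᵀ * J⁻¹ := by
    intro M
    have hJi : J⁻¹ = !![0, -1; 1, 0] := by
      apply Matrix.inv_eq_right_inv
      ext i j
      fin_cases i <;> fin_cases j <;> simp [J, Matrix.mul_apply, Fin.sum_univ_two]
    rw [hJi]
    ext i j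
    fin_cases i <;> fin_cases j <;>
      simp [J, Matrix.mul_apply, Fin.sum_univ_two, Matrix.adjugate_fin_two, Matrix.vecMul,
        dotProduct]
  have hneg : A.adjugate = -A := by
    rw [Matrix.trace_fin_two] at hA
    ext i j
    fin_cases i <;> fin_cases j <;> simp [Matrix.adjugate_fin_two]
    · linear_combination hA
    · linear_combination hA
  have h1 : NormedSpace.exp (-A) = (NormedSpace.exp A).adjugate := by
    rw [← hneg, hadj, hadj, Matrix.exp_conj _ _ hJ, Matrix.exp_transpose]
  have h2 : NormedSpace.exp A * NormedSpace.exp (-A) = 1 := by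
    rw [← Matrix.exp_add_of_commute A (-A) (Commute.neg_right (Commute.refl A)), add_neg_cancel,
      NormedSpace.exp_zero]
  rw [h1, Matrix.mul_adjugate] at h2
  have := congrFun (congrFun h2 0) 0
  simpa using this

/-- The exponential map of `SL(2,ℂ)`. -/
def expSL (A : sl2) : SL2 :=
  ⟨NormedSpace.exp (A : Mat2), det_exp_of_trace_zero A A.2⟩

/-- The derivative of `f` at `g` along the left-invariant vector field `g ↦ gA`. -/
def dirDeriv {E : Type*} [NormedAddCommGroup E] [NormedSpace ℝ E]
    (f : SL2 → E) (g : SL2) (A : sl2) : E :=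
  deriv (fun t : ℝ => f (g * expSL (t • A))) 0

/-- Smoothness of a map on the closed submanifold `SL(2,ℂ)` of the space of `2 × 2` matrices:
it is the restriction of a smooth map of the (real and imaginary parts of the) entries. -/
def IsSmooth {E : Type*} [NormedAddCommGroup E] [NormedSpace ℝ E] (f : SL2 → E) : Prop :=
  ∃ F : (Fin 2 → Fin 2 → ℂ) → E, ContDiff ℝ ∞ F ∧ ∀ g : SL2, f g = F (fun i j => (g : Mat2) i j)

/-! ## Tangent vectors and the Levi-Civita connection of AdS along the slice

Near the slice, `AdS^{3,1}` is the hyperquadric `-det W - s² = -1` in `𝔐 × ℝ = ℝ^{3,2}`, the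
hyperbolic slice `ℍ³` is `{s = 0, trace W > 0}`, with unit normal `e₀ = ∂_s`.
An element of the bundle `T(AdS)|_{ℍ³} = SL(2,ℂ) ×_μ 𝔐` is a class `{g, X}`, with `{gh, X} = {g, h X h*}`
for `h ∈ SU(2)`; it is tangent to `ℍ³` when `X ∈ 𝔊`, and `{g, I/2} = e₀`. For `ζ ∈ 𝔊` the vector
`{g, ζ}` is the velocity at `t = 0` of the curve `g exp(tζ)` of `SL(2,ℂ)/SU(2)`, i.e. of
`(g exp(tζ)) (g exp(tζ))*` in the hyperboloid. -/

/-- The metric of the ambient space `𝔐 × ℝ = ℝ^{3,2}`. -/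
def ambForm (P Q : Mat2 × ℝ) : ℝ := mink P.1 Q.1 - P.2 * Q.2

/-- The class `{g, X}` as a vector of the ambient space: `2 g ζ g*` for `X = ζ ∈ 𝔊`, and
`e₀ = ∂_s` for `X = I/2`. -/
def tangentVec (g : SL2) (X : Mat2) : Mat2 × ℝ :=
  ((2 : ℂ) • ((g : Mat2) * (X - (X.trace / 2) • (1 : Mat2)) * (g : Mat2)ᴴ), X.trace.re)

/-- `halfBasis k` is the constant `X` such that `{g, X}` is the `k`-th vector `e_k` of the
orthonormal frame of AdS determined by `g`. -/
def halfBasis (k : Fin 4) : Mat2 := (1 / 2 : ℂ) • basisMat k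

theorem halfBasis_succ_mem (k : Fin 3) : halfBasis k.succ ∈ hermTraceless := by
  refine ⟨?_, ?_⟩
  · change (halfBasis k.succ)ᴴ = _
    ext i j
    fin_cases k <;> fin_cases i <;> fin_cases j <;>
      simp [halfBasis, basisMat, lam, Fin.ext_iff]
  · change (halfBasis k.succ).trace = 0
    fin_cases k <;>
      simp [halfBasis, basisMat, lam, Matrix.trace_fin_two, Fin.ext_iff]

/-- `e_k` for `k = 1, 2, 3`, the part of the frame tangent to `ℍ³`. -/
def halfBasisT (k : Fin 3) : hermTraceless := ⟨halfBasis k.succ, halfBasis_succ_mem k⟩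

/-- `β(e_k, e_k)`. -/
def frameSign (k : Fin 4) : ℝ := if k = 0 then -1 else 1

/-- `β(D_A {·, X}, e_k)` at `g`, where `D` is the Levi-Civita connection of AdS and `{·, X}` is the
vector field `{g exp(tA), X}` along the curve of base points of `g exp(tA)`. As AdS has the
metric induced from the ambient space, `D` is the tangential part of the ambient derivative,
and pairing with the tangent vector `e_k` picks that part. -/
def connCoeff (g : SL2) (A : sl2) (X : Mat2) (k : Fin 4) : ℝ :=
  deriv (fun t : ℝ =>
    ambForm (tangentVec (g * expSL (t • A)) X) (tangentVec g (halfBasis k))) 0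

/-! ## Spinors -/

/-- The representation `g ↦ diag(g, (g*)⁻¹)` of `SL(2,ℂ)` on `ℂ⁴`. -/
def rho (g : SL2) (ψ : Spinor) : Spinor :=
  ((g : Mat2) *ᵥ ψ.1, (((conjT g)⁻¹ : SL2) : Mat2) *ᵥ ψ.2)

/-- Clifford multiplication `Θ(X)`, with blocks `0, 2X, 2X̂, 0`, where `X̂` is the transposed
comatrix. -/
def cliff (X : Mat2) (ψ : Spinor) : Spinor :=
  ((2 : ℂ) • (X *ᵥ ψ.2), (2 : ℂ) • (X.adjugate *ᵥ ψ.1))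

/-- The standard Hermitian product of `ℂ⁴`, linear in the first variable. -/
def hermProd (ξ η : Spinor) : ℂ := ξ.1 ⬝ᵥ star η.1 + ξ.2 ⬝ᵥ star η.2

/-- Smooth sections `g ↦ {g, v(g)}` of the spinor bundle `Σ = SL(2,ℂ) ×_{ρ|SU(2)} ℂ⁴` over `ℍ³`,
as `SU(2)`-equivariant maps. -/
def IsSpinorField (v : SL2 → Spinor) : Prop :=
  IsSmooth v ∧ ∀ g : SL2, ∀ h ∈ SU2, v (g * h) = rho h⁻¹ (v g)

/-- The spinorial Levi-Civita derivative of the spinor field `v` at `g` in the direction of the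
curve of base points of `g exp(tA)`: the derivative of the components in the moving
spin frame plus `½ ∑_{i<j} ω_{ij}(A) e_i · e_j ·`, with connection forms `ω_{ij} = β(D e_i, e_j)`
(indices raised with the signs of the Lorentzian frame). -/
def spinDeriv (v : SL2 → Spinor) (g : SL2) (A : sl2) : Spinor :=
  dirDeriv v g A + (1 / 2 : ℝ) • ∑ i : Fin 4, ∑ j ∈ Finset.Ioi i,
    (frameSign i * frameSign j * connCoeff g A (halfBasis i) j) •
      cliff (halfBasis i) (cliff (halfBasis j) (v g))

/-- The inclusion `𝔊 ⊂ 𝔰𝔩₂(ℂ)`. -/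
def toSl2 (ζ : hermTraceless) : sl2 := ⟨ζ, ζ.2.2⟩

/-- `IKS(Σ)`: spinor fields with `D_Y σ + (i/2) Y · σ = 0` for every vector `Y = {g, ζ}` tangent to
the slice `ℍ³` of AdS, `D` being the Levi-Civita connection of AdS. -/
def IKS : Set (SL2 → Spinor) :=
  {v | IsSpinorField v ∧ ∀ (g : SL2) (ζ : hermTraceless),
    spinDeriv v g (toSl2 ζ) + (Complex.I / 2) • cliff ζ (v g) = 0}

/-- `σ⁻¹_{w⊗z}[g] = {g, z(g⁻¹ w)}`. -/
def sigmaInv (w z : C2) (g : SL2) : Spinor :=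
  (z 0 • (((g⁻¹ : SL2) : Mat2) *ᵥ w), z 1 • (((g⁻¹ : SL2) : Mat2) *ᵥ w))

/-- `σ*_{u⊗z}[g] = {g, z(g* u)}`. -/
def sigmaStar (u z : C2) (g : SL2) : Spinor :=
  (z 0 • ((g : Mat2)ᴴ *ᵥ u), z 1 • ((g : Mat2)ᴴ *ᵥ u))

/-- The spinor field `σ⁻¹_{w⊗(1,-i)} + σ*_{u⊗(1,i)}` attached to `w ⊕ u`. -/
def killingSpinor (p : C2 × C2) : SL2 → Spinor :=
  sigmaInv p.1 ![1, -Complex.I] + sigmaStar p.2 ![1, Complex.I]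

/-- The action `(e ∗ v)(g) = v(e⁻¹ g)` of `SL(2,ℂ)` on spinor fields. -/
def actField (e : SL2) (v : SL2 → Spinor) : SL2 → Spinor := fun g => v (e⁻¹ * g)

/-- The action `e ∗ (w ⊕ u) = e w ⊕ (e*)⁻¹ u` on `ℂ² ⊕ ℂ²`. -/
def actPair (e : SL2) (p : C2 × C2) : C2 × C2 :=
  ((e : Mat2) *ᵥ p.1, (((conjT e)⁻¹ : SL2) : Mat2) *ᵥ p.2)

/-! ## Functions and 1-forms on `ℍ³` -/

/-- `D_A α ({g, ξ})` for the 1-form `α`, where `α g ξ` stands for the value on `{g, ξ}`: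
`D_A α (Y) = A (α(Y)) - α(D_A Y)` with `Y = {·, ξ}` along the curve of base points of `g exp(tA)`. -/
def formDeriv (α : SL2 → hermTraceless → ℝ) (g : SL2) (A : sl2) (ξ : hermTraceless) : ℝ :=
  dirDeriv (fun g' => α g' ξ) g A
    - ∑ k : Fin 3, connCoeff g A ξ k.succ * α g (halfBasisT k)

/-- Smooth 1-forms on `ℍ³`: `α g ξ` is the value on the tangent vector `{g, ξ}`. -/
def IsOneForm (α : SL2 → hermTraceless → ℝ) : Prop :=
  (∀ g, IsLinearMap ℝ (α g)) ∧ (∀ ξ, IsSmooth (fun g => α g ξ)) ∧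
  ∀ g : SL2, ∀ h ∈ SU2, ∀ ξ ξ' : hermTraceless,
    (ξ' : Mat2) = (h : Mat2) * (ξ : Mat2) * (h : Mat2)ᴴ → α (g * h) ξ = α g ξ'

/-- Killing 1-forms on `ℍ³`: those whose covariant derivative is skew-symmetric. -/
def IsKillingForm (α : SL2 → hermTraceless → ℝ) : Prop :=
  IsOneForm α ∧ ∀ (g : SL2) (η ξ : hermTraceless),
    formDeriv α g (toSl2 η) ξ + formDeriv α g (toSl2 ξ) η = 0

/-- The differential of a function on `ℍ³`. -/
def differential (f : SL2 → ℝ) (g : SL2) (ξ : hermTraceless) : ℝ := dirDeriv f g (toSl2 ξ)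

/-- `N_b`: the smooth functions on `ℍ³ = SL(2,ℂ)/SU(2)` with `Hess f = f b`. -/
def Nb : Set (SL2 → ℝ) :=
  {f | IsSmooth f ∧ (∀ g : SL2, ∀ h ∈ SU2, f (g * h) = f g) ∧
    ∀ (g : SL2) (η ξ : hermTraceless),
      formDeriv (differential f) g (toSl2 η) ξ
        = f g * ambForm (tangentVec g η) (tangentVec g ξ)}

/-- An element of `N_b` is causal if it is the restriction to `ℍ³` of a linear form
`∑ a_k y_k` on `ℝ^{3,1}` with `-a₀² + a₁² + a₂² + a₃² ≤ 0`; the coordinates of a point `W` of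
`ℍ³ ⊂ 𝔐` are those of `Λ⁻¹(W)`. -/
def IsCausal (f : SL2 → ℝ) : Prop :=
  ∃ a : Fin 4 → ℝ, -(a 0) ^ 2 + (a 1) ^ 2 + (a 2) ^ 2 + (a 3) ^ 2 ≤ 0 ∧
    ∀ (g : SL2) (x : Fin 4 → ℝ), lam x = basePoint g → f g = ∑ k, a k * x k

/-- `V_σ = ⟨σ, σ⟩`. -/
def normFun (v : SL2 → Spinor) (g : SL2) : ℝ := (hermProd (v g) (v g)).re

/-- `⟨Y · e₀ · σ, σ⟩` for `Y = {g, ξ}`, with `e₀ = {g, I/2}`. -/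
def currentC (v : SL2 → Spinor) (g : SL2) (ξ : hermTraceless) : ℂ :=
  hermProd (cliff ξ (cliff ((1 / 2 : ℂ) • (1 : Mat2)) (v g))) (v g)

/-- The 1-form `α_σ(Y) = ⟨Y · e₀ · σ, σ⟩`. -/
def current (v : SL2 → Spinor) (g : SL2) (ξ : hermTraceless) : ℝ := (currentC v g ξ).re

/-! ## The map `𝒦` -/

/-- `V_{w⊕u}(W) = 2 (w* Ŵ w + u* W u)`, a real linear form on `𝔐`. -/
def VForm (p : C2 × C2) : herm2 →ₗ[ℝ] ℝ where
  toFun W := (2 * (star p.1 ⬝ᵥ ((W : Mat2).adjugate *ᵥ p.1)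
    + star p.2 ⬝ᵥ ((W : Mat2) *ᵥ p.2))).re
  map_add' X Y := by
    have h : ((X : Mat2) + (Y : Mat2)).adjugate = (X : Mat2).adjugate + (Y : Mat2).adjugate := by
      ext i j
      fin_cases i <;> fin_cases j <;> simp [Matrix.adjugate_fin_two] <;> ring
    rw [Submodule.coe_add, h, Matrix.add_mulVec, Matrix.add_mulVec, dotProduct_add,
      dotProduct_add, ← Complex.add_re]
    congr 1
    ring
  map_smul' c X := by
    have h : (c • (X : Mat2)).adjugate = c • (X : Mat2).adjugate := by
      ext i j
      fin_cases i <;> fin_cases j <;> simp [Matrix.adjugate_fin_two]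
    rw [Submodule.coe_smul, h, Matrix.smul_mulVec, Matrix.smul_mulVec, dotProduct_smul,
      dotProduct_smul, ← smul_add, mul_smul_comm, Complex.smul_re]
    rfl

/-- `α_{w⊕u}(ξ) = 2 (w* ξ u + u* ξ* w)`, a real linear form on `𝔰𝔩₂(ℂ)`. -/
def alphaForm (p : C2 × C2) : sl2 →ₗ[ℝ] ℝ where
  toFun ξ := (2 * (star p.1 ⬝ᵥ ((ξ : Mat2) *ᵥ p.2)
    + star p.2 ⬝ᵥ ((ξ : Mat2)ᴴ *ᵥ p.1))).re
  map_add' X Y := by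
    rw [Submodule.coe_add, Matrix.conjTranspose_add, Matrix.add_mulVec, Matrix.add_mulVec,
      dotProduct_add, dotProduct_add, ← Complex.add_re]
    congr 1
    ring
  map_smul' c X := by
    rw [Submodule.coe_smul, Matrix.conjTranspose_smul, star_trivial (c : ℝ), Matrix.smul_mulVec,
      Matrix.smul_mulVec, dotProduct_smul, dotProduct_smul, ← smul_add, mul_smul_comm,
      Complex.smul_re]
    rfl

/-- `𝒦_{w⊕u} = V_{w⊕u} ⊕ α_{w⊕u}` in the real dual of `𝔐 ⊕ 𝔰𝔩₂(ℂ)`. -/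
def killingMap (p : C2 × C2) : Module.Dual ℝ (herm2 × sl2) :=
  LinearMap.coprod (VForm p) (alphaForm p)

/-- The set of spinor fields `σ⁻¹_{w⊗(1,-i)}` and `σ*_{u⊗(1,i)}`. -/
def generators : Set (SL2 → Spinor) :=
  {v | ∃ w : C2, v = sigmaInv w ![1, -Complex.I] ∨ v = sigmaStar w ![1, Complex.I]}

end HypSpin

end

noncomputable section

namespace HypSpin

/-! ### Derivatives along left-invariant directions of `SL2` -/

section Derivatives

attribute [local instance] Matrix.linftyOpNormedAddCommGroup Matrix.linftyOpNormedSpace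
  Matrix.linftyOpNormedRing Matrix.linftyOpNormedAlgebra

/-! Everything rests on one identity: traceless `2 × 2` matrices satisfy `AB + BA = tr(AB) I`. For
`ζ` in `𝔊`, the derivative of `g X₀ g*` along `ζ`, with `X₀` traceless, is `g (ζ X₀ + X₀ ζ) g*`.
This is a multiple of the position vector `g g*`, hence normal to the hyperboloid. So the connection
coefficients vanish in the directions of `𝔊` (`connCoeff_eq_zero`), and `D` becomes the plain
derivative of equivariant maps.

The Killing equation for `v = (x, y)` is then linear: `x' = -iζy`, `y' = iζx`. It is diagonalized by
`P = x + iy` and `Q = x - iy`, with `P' = -ζP` and `Q' = ζQ`. Hence `g P` and `(g*)⁻¹ Q` have zero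
derivative in the directions of `𝔊`. Both are right `SU(2)`-invariant, so by the polar decomposition
(`exists_polar`) they are constant, which forces `P = g⁻¹ P(1)` and `Q = g* Q(1)`. This is
`exists_killingSpinor_of_mem_IKS`; the converse is a differentiation.

Put `a = g⁻¹w` and `b = g*u`. The parallelogram law turns `⟨σ, σ⟩` into `2(|a|² + |b|²)`, a linear
form in `g g*`, and polarization turns `α_σ` into the cross terms of `a` and `b`. Differentiating,
the anticommutator identity gives the Hessian equation for `V_σ`, while `D α_σ` is a commutator,
hence skew. Causality holds because the coefficient vector is a sum of two null vectors in the same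
closed half-cone. Equivariance is read off from `a` and `b`. -/

/-- The adjugate of `2 × 2` matrices as a linear map. -/
def adjugateLin : Mat2 →ₗ[ℝ] Mat2 where
  toFun X := X.adjugate
  map_add' X Y := by
    ext i j
    fin_cases i <;> fin_cases j <;> simp [Matrix.adjugate_fin_two] <;> ring
  map_smul' c X := by
    ext i j
    fin_cases i <;> fin_cases j <;> simp [Matrix.adjugate_fin_two]

theorem _root_.HasDerivAt.linearMap_comp {E F : Type*} [NormedAddCommGroup E] [NormedSpace ℝ E]
    [FiniteDimensional ℝ E] [NormedAddCommGroup F] [NormedSpace ℝ F] {M : ℝ → E} {M' : E} {t : ℝ}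
    (h : HasDerivAt M M' t) (L : E →ₗ[ℝ] F) : HasDerivAt (fun s => L (M s)) (L M') t :=
  (LinearMap.toContinuousLinearMap L).hasFDerivAt.comp_hasDerivAt t h

@[simp] theorem expSL_zero : expSL 0 = 1 := by
  apply Subtype.ext
  simp [expSL, NormedSpace.exp_zero]

theorem expSL_add_smul (A : sl2) (s t : ℝ) :
    expSL ((s + t) • A) = expSL (s • A) * expSL (t • A) := by
  apply Subtype.ext
  change NormedSpace.exp ((((s + t) • A : sl2)) : Mat2)
    = NormedSpace.exp (((s • A : sl2)) : Mat2) * NormedSpace.exp (((t • A : sl2)) : Mat2)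
  rw [add_smul, Submodule.coe_add]
  apply Matrix.exp_add_of_commute
  simp only [Submodule.coe_smul]
  exact ((Commute.refl (A : Mat2)).smul_left s).smul_right t

theorem hasDerivAt_mul_expSL (g : SL2) (A : sl2) :
    HasDerivAt (fun t : ℝ => ((g * expSL (t • A) : SL2) : Mat2)) ((g : Mat2) * (A : Mat2)) 0 := by
  have h := (hasDerivAt_exp_smul_const (𝕂 := ℝ) (A : Mat2) (0 : ℝ)).const_mul (g : Mat2)
  rw [zero_smul, NormedSpace.exp_zero, one_mul] at h
  exact h

/-- Cayley–Hamilton: the adjugate of a `2 × 2` matrix is `tr A - A`. The same sign appears in the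
derivative of the inverse and in Clifford multiplication by vectors of `𝔊`. -/
theorem adjugate_of_mem_sl2 {A : Mat2} (hA : A ∈ sl2) : A.adjugate = -A := by
  have hA : A.trace = 0 := hA
  rw [Matrix.trace_fin_two] at hA
  ext i j
  fin_cases i <;> fin_cases j <;> simp [Matrix.adjugate_fin_two]
  · linear_combination hA
  · linear_combination hA

/-- On `SL2` the inverse is the adjugate, which is linear in size two, so the derivative of `g` is
simply pushed through `adjugateLin`. -/
theorem hasDerivAt_mul_expSL_inv (g : SL2) (A : sl2) :
    HasDerivAt (fun t : ℝ => (((g * expSL (t • A))⁻¹ : SL2) : Mat2))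
      (-((A : Mat2) * ((g⁻¹ : SL2) : Mat2))) 0 := by
  have h := (hasDerivAt_mul_expSL g A).linearMap_comp adjugateLin
  have e : adjugateLin ((g : Mat2) * (A : Mat2)) = -((A : Mat2) * ((g⁻¹ : SL2) : Mat2)) := by
    change ((g : Mat2) * (A : Mat2)).adjugate = _
    rw [Matrix.adjugate_mul_distrib, adjugate_of_mem_sl2 A.2, Matrix.SpecialLinearGroup.coe_inv,
      neg_mul]
  rw [e] at h
  refine h.congr_of_eventuallyEq (Filter.Eventually.of_forall fun t => ?_)
  exact Matrix.SpecialLinearGroup.coe_inv _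

theorem hasDerivAt_mul_expSL_conjTranspose (g : SL2) (A : sl2) :
    HasDerivAt (fun t : ℝ => ((g * expSL (t • A) : SL2) : Mat2)ᴴ)
      ((A : Mat2)ᴴ * (g : Mat2)ᴴ) 0 := by
  rw [← Matrix.conjTranspose_mul]
  exact (hasDerivAt_mul_expSL g A).linearMap_comp
    (Matrix.conjTransposeLinearEquiv (Fin 2) (Fin 2) ℝ ℂ).toLinearMap

/-- The derivative of `g ↦ L (g M g*)`. -/
theorem hasDerivAt_congr_conj {E : Type*} [NormedAddCommGroup E] [NormedSpace ℝ E]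
    (L : Mat2 →ₗ[ℝ] E) (M : Mat2) (g : SL2) (A : sl2) :
    HasDerivAt (fun t : ℝ => L (((g * expSL (t • A) : SL2) : Mat2) * M
        * ((g * expSL (t • A) : SL2) : Mat2)ᴴ))
      (L ((g : Mat2) * ((A : Mat2) * M + M * (A : Mat2)ᴴ) * (g : Mat2)ᴴ)) 0 := by
  have h := (((hasDerivAt_mul_expSL g A).mul_const M).mul
    (hasDerivAt_mul_expSL_conjTranspose g A)).linearMap_comp L
  refine h.congr_deriv ?_
  simp [mul_add, add_mul, mul_assoc]

/-- The derivative of `g ↦ L ((g*)⁻¹ M g*)`. -/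
theorem hasDerivAt_conj_conjT {E : Type*} [NormedAddCommGroup E] [NormedSpace ℝ E]
    (L : Mat2 →ₗ[ℝ] E) (M : Mat2) (g : SL2) (A : sl2) :
    HasDerivAt (fun t : ℝ => L ((((g * expSL (t • A))⁻¹ : SL2) : Mat2)ᴴ * M
        * ((g * expSL (t • A) : SL2) : Mat2)ᴴ))
      (L (((g⁻¹ : SL2) : Mat2)ᴴ * (M * (A : Mat2)ᴴ - (A : Mat2)ᴴ * M) * (g : Mat2)ᴴ)) 0 := by
  have h := ((((hasDerivAt_mul_expSL_inv g A).linearMap_comp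
    (Matrix.conjTransposeLinearEquiv (Fin 2) (Fin 2) ℝ ℂ).toLinearMap).mul_const M).mul
    (hasDerivAt_mul_expSL_conjTranspose g A)).linearMap_comp L
  refine h.congr_deriv ?_
  simp [mul_sub, sub_mul, mul_assoc]
  abel

theorem hasDerivAt_entries_mul_expSL (g : SL2) (A : sl2) :
    HasDerivAt (fun (t : ℝ) (i j : Fin 2) => ((g * expSL (t • A) : SL2) : Mat2) i j)
      (fun i j => ((g : Mat2) * (A : Mat2)) i j) 0 :=
  (hasDerivAt_mul_expSL g A).linearMap_comp (F := Fin 2 → Fin 2 → ℂ)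
    { toFun := fun M i j => M i j, map_add' := fun _ _ => rfl, map_smul' := fun _ _ => rfl }

theorem hasDerivAt_inv_mulVec (g : SL2) (A : sl2) (w : C2) :
    HasDerivAt (fun t : ℝ => (((g * expSL (t • A))⁻¹ : SL2) : Mat2) *ᵥ w)
      (-((A : Mat2) *ᵥ (((g⁻¹ : SL2) : Mat2) *ᵥ w))) 0 := by
  have h := (hasDerivAt_mul_expSL_inv g A).linearMap_comp (F := C2)
    { toFun := fun M => M *ᵥ w, map_add' := fun _ _ => Matrix.add_mulVec _ _ _,
      map_smul' := fun _ _ => Matrix.smul_mulVec _ _ _ }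
  refine h.congr_deriv ?_
  change (-((A : Mat2) * ((g⁻¹ : SL2) : Mat2))) *ᵥ w = _
  rw [Matrix.neg_mulVec, Matrix.mulVec_mulVec]

theorem hasDerivAt_conjTranspose_mulVec (g : SL2) (A : sl2) (w : C2) :
    HasDerivAt (fun t : ℝ => ((g * expSL (t • A) : SL2) : Mat2)ᴴ *ᵥ w)
      ((A : Mat2)ᴴ *ᵥ ((g : Mat2)ᴴ *ᵥ w)) 0 := by
  have h := (hasDerivAt_mul_expSL_conjTranspose g A).linearMap_comp (F := C2)
    { toFun := fun M => M *ᵥ w, map_add' := fun _ _ => Matrix.add_mulVec _ _ _,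
      map_smul' := fun _ _ => Matrix.smul_mulVec _ _ _ }
  refine h.congr_deriv ?_
  change ((A : Mat2)ᴴ * (g : Mat2)ᴴ) *ᵥ w = _
  rw [Matrix.mulVec_mulVec]

end Derivatives

theorem IsSmooth.hasDerivAt {E : Type*} [NormedAddCommGroup E] [NormedSpace ℝ E] {f : SL2 → E}
    (hf : IsSmooth f) (g : SL2) (A : sl2) :
    HasDerivAt (fun t : ℝ => f (g * expSL (t • A))) (dirDeriv f g A) 0 := by
  obtain ⟨F, hF, hfF⟩ := hf
  apply DifferentiableAt.hasDerivAt
  simp only [hfF]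
  exact ((hF.differentiable (by simp)).differentiableAt).comp (0 : ℝ)
    (hasDerivAt_entries_mul_expSL g A).differentiableAt

/-- Transport of a derivative along the one-parameter group from `0` to `t`. -/
theorem hasDerivAt_along_expSL {E : Type*} [NormedAddCommGroup E] [NormedSpace ℝ E] {f : SL2 → E}
    {A : sl2} {f' : SL2 → E}
    (hf : ∀ g, HasDerivAt (fun t : ℝ => f (g * expSL (t • A))) (f' g) 0) (g : SL2) (t : ℝ) :
    HasDerivAt (fun s : ℝ => f (g * expSL (s • A))) (f' (g * expSL (t • A))) t := by
  have h := hf (g * expSL (t • A))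
  -- The group law writes `g exp(sA)` as `g exp(tA) exp((s - t)A)`, so the derivative at `t` is the
  -- one at `0` based at `g exp(tA)`.
  have h2 := HasDerivAt.scomp_of_eq t h ((hasDerivAt_id t).sub_const t) (sub_self t).symm
  simp only [one_smul] at h2
  refine h2.congr_of_eventuallyEq (Filter.Eventually.of_forall fun s => ?_)
  simp only [Function.comp, id, mul_assoc, ← expSL_add_smul]
  congr 3
  simp

theorem eq_of_hasDerivAt_zero {E : Type*} [NormedAddCommGroup E] [NormedSpace ℝ E] {f : SL2 → E}
    {A : sl2} (hf : ∀ g, HasDerivAt (fun t : ℝ => f (g * expSL (t • A))) 0 0) (g : SL2) :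
    f (g * expSL A) = f g := by
  have h := hasDerivAt_along_expSL (f' := fun _ => 0) hf g
  have := is_const_of_deriv_eq_zero (f := fun s : ℝ => f (g * expSL (s • A)))
    (fun t => (h t).differentiableAt) (fun t => (h t).deriv) 1 0
  simpa using this

/-! ### The polar decomposition of `SL(2,ℂ)` -/

-- Take `ζ` to be half the logarithm of the positive matrix `g g*`, computed in an eigenbasis. With
-- `e = exp ζ` one has `e² = g g*`, and this makes `e⁻¹ g` unitary.
open scoped ComplexOrder in
theorem exists_polar (g : SL2) : ∃ ζ : hermTraceless, ∃ h ∈ SU2, g = expSL (toSl2 ζ) * h := by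
  have hH : (basePoint g).IsHermitian := Matrix.isHermitian_mul_conjTranspose_self _
  have hdet : (basePoint g).det = 1 := by
    simp [basePoint, Matrix.det_mul, Matrix.det_conjTranspose]
  have hpos : (basePoint g).PosDef := by
    have := Matrix.posSemidef_self_mul_conjTranspose (g : Mat2)
    exact this.posDef_iff_isUnit.2 ((Matrix.isUnit_iff_isUnit_det _).2 (by
      change IsUnit (basePoint g).det
      rw [hdet]; exact isUnit_one))
  have hev : ∀ i, 0 < hH.eigenvalues i := fun i => hpos.eigenvalues_pos i
  set U : Mat2 := (hH.eigenvectorUnitary : Mat2) with hU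
  have hUU : U * Uᴴ = 1 := Matrix.mem_unitaryGroup_iff.1 hH.eigenvectorUnitary.2
  have hUU' : Uᴴ * U = 1 := Matrix.mem_unitaryGroup_iff'.1 hH.eigenvectorUnitary.2
  have hspec : basePoint g
      = U * Matrix.diagonal (fun i => ((hH.eigenvalues i : ℝ) : ℂ)) * Uᴴ := by
    have := hH.spectral_theorem
    rw [Unitary.conjStarAlgAut_apply] at this
    exact this
  set d : Fin 2 → ℂ := fun i => ((Real.log (hH.eigenvalues i) / 2 : ℝ) : ℂ) with hd
  set Z : Mat2 := U * Matrix.diagonal d * Uᴴ with hZ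
  have hZH : Zᴴ = Z := by
    have : star d = d := by
      ext i; simp [hd]
    simp only [hZ, Matrix.conjTranspose_mul, Matrix.conjTranspose_conjTranspose,
      Matrix.diagonal_conjTranspose, this, mul_assoc]
  have hZt : Z.trace = 0 := by
    rw [hZ, Matrix.trace_mul_comm, ← mul_assoc, hUU', one_mul, Matrix.trace_diagonal]
    -- Since `det (g g*) = 1`, the two eigenvalues are inverse to each other and their logarithms
    -- cancel in the trace.
    have h1 := hH.det_eq_prod_eigenvalues
    rw [hdet, Fin.prod_univ_two] at h1
    have h2 : hH.eigenvalues 0 * hH.eigenvalues 1 = 1 := by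
      apply Complex.ofReal_injective
      rw [Complex.ofReal_mul]
      exact h1.symm
    have h3 : Real.log (hH.eigenvalues 0) + Real.log (hH.eigenvalues 1) = 0 := by
      rw [← Real.log_mul (hev 0).ne' (hev 1).ne', h2, Real.log_one]
    rw [Fin.sum_univ_two]
    simp only [hd]
    rw [← Complex.ofReal_add, ← add_div, h3]
    simp
  have hUi : U⁻¹ = Uᴴ := Matrix.inv_eq_right_inv hUU
  have hexp : NormedSpace.exp Z = U * Matrix.diagonal (NormedSpace.exp d) * Uᴴ := by
    rw [hZ, ← hUi, Matrix.exp_conj _ _ (IsUnit.of_mul_eq_one _ hUU), Matrix.exp_diagonal]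
  have hsq : NormedSpace.exp Z * NormedSpace.exp Z = basePoint g := by
    rw [hexp, hspec]
    have e : ∀ D : Mat2, U * D * Uᴴ * (U * D * Uᴴ) = U * (D * D) * Uᴴ := by
      intro D
      calc U * D * Uᴴ * (U * D * Uᴴ) = U * D * (Uᴴ * U) * D * Uᴴ := by simp only [mul_assoc]
        _ = _ := by rw [hUU']; simp only [mul_assoc, mul_one]
    rw [e, Matrix.diagonal_mul_diagonal]
    congr 3
    ext i
    rw [Pi.coe_exp, ← Complex.exp_eq_exp_ℂ, ← Complex.exp_add, hd]
    dsimp only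
    rw [← Complex.ofReal_add, add_halves, ← Complex.ofReal_exp, Real.exp_log (hev i)]
  have hEH : (NormedSpace.exp Z)ᴴ = NormedSpace.exp Z := by
    rw [← Matrix.exp_conjTranspose, hZH]
  let ζ : hermTraceless := ⟨Z, hZH, hZt⟩
  let e : SL2 := expSL (toSl2 ζ)
  refine ⟨ζ, e⁻¹ * g, ?_, by simp [e]⟩
  have he : (e : Mat2) = NormedSpace.exp Z := rfl
  have h1 : (e : Mat2) * ((e⁻¹ : SL2) : Mat2) = 1 := by
    rw [← Matrix.SpecialLinearGroup.coe_mul, mul_inv_cancel, Matrix.SpecialLinearGroup.coe_one]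
  have h2 : ((e⁻¹ : SL2) : Mat2) * (e : Mat2) = 1 := by
    rw [← Matrix.SpecialLinearGroup.coe_mul, inv_mul_cancel, Matrix.SpecialLinearGroup.coe_one]
  have h3 : ((e⁻¹ : SL2) : Mat2)ᴴ = ((e⁻¹ : SL2) : Mat2) := by
    rw [Matrix.SpecialLinearGroup.coe_inv, he, Matrix.adjugate_conjTranspose, hEH]
  change ((e⁻¹ * g : SL2) : Mat2) ∈ Matrix.unitaryGroup (Fin 2) ℂ
  rw [Matrix.mem_unitaryGroup_iff, Matrix.star_eq_conjTranspose,
    Matrix.SpecialLinearGroup.coe_mul, Matrix.conjTranspose_mul, h3]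
  calc ((e⁻¹ : SL2) : Mat2) * (g : Mat2) * ((g : Mat2)ᴴ * ((e⁻¹ : SL2) : Mat2))
      = ((e⁻¹ : SL2) : Mat2) * basePoint g * ((e⁻¹ : SL2) : Mat2) := by
        simp only [basePoint, mul_assoc]
    _ = (((e⁻¹ : SL2) : Mat2) * (e : Mat2)) * ((e : Mat2) * ((e⁻¹ : SL2) : Mat2)) := by
        rw [← hsq, he]; simp only [mul_assoc]
    _ = 1 := by rw [h1, h2, one_mul]

/-- A function on `SL(2,ℂ)/SU(2)` whose derivatives vanish is constant. -/
theorem eq_of_invariant_of_hasDerivAt_zero {E : Type*} [NormedAddCommGroup E] [NormedSpace ℝ E]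
    {f : SL2 → E} (hinv : ∀ g, ∀ h ∈ SU2, f (g * h) = f g)
    (hf : ∀ g (ζ : hermTraceless),
      HasDerivAt (fun t : ℝ => f (g * expSL (t • toSl2 ζ))) 0 0) (g : SL2) : f g = f 1 := by
  -- The curve `exp(tζ)` joins `1` to `exp ζ`, and invariance removes the unitary factor.
  obtain ⟨ζ, h, hh, rfl⟩ := exists_polar g
  rw [hinv _ h hh, ← eq_of_hasDerivAt_zero (fun g => hf g ζ) 1, one_mul]

/-! ### Vanishing of the connection coefficients in the symmetric directions -/

theorem conjTranspose_coe (ζ : hermTraceless) : (ζ : Mat2)ᴴ = ζ := ζ.2.1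

theorem trace_coe (ζ : hermTraceless) : (ζ : Mat2).trace = 0 := ζ.2.2

/-- Polarized Cayley–Hamilton, i.e. the Clifford relation. It is behind both the vanishing of the
connection coefficients and the Hessian equation. -/
theorem mul_add_mul_eq_smul_one {A B : Mat2} (hA : A.trace = 0) (hB : B.trace = 0) :
    A * B + B * A = (A * B).trace • (1 : Mat2) := by
  rw [Matrix.trace_fin_two] at hA hB
  have hA' : A 1 1 = -A 0 0 := by linear_combination hA
  have hB' : B 1 1 = -B 0 0 := by linear_combination hB
  ext i j
  fin_cases i <;> fin_cases j <;>
    simp [Matrix.mul_apply, Fin.sum_univ_two, Matrix.trace_fin_two, hA', hB'] <;> ring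

theorem mink_eq (X Y : Mat2) :
    mink X Y = -(X 0 0 * Y 1 1 + X 1 1 * Y 0 0 - X 0 1 * Y 1 0 - X 1 0 * Y 0 1).re / 2 := by
  unfold mink
  congr 3
  simp only [Matrix.det_fin_two, Matrix.add_apply]
  ring

/-- `mink X Y` as a linear form in `X`. -/
def minkLin (Y : Mat2) : Mat2 →ₗ[ℝ] ℝ where
  toFun X := mink X Y
  map_add' X X' := by simp only [mink_eq, Matrix.add_apply, ← Complex.add_re,
      ← Complex.neg_re, ← add_div]; congr 2; ring
  map_smul' c X := by
    simp [mink_eq]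
    ring

theorem mink_conj (g : SL2) (X Y : Mat2) :
    mink ((g : Mat2) * X * (g : Mat2)ᴴ) ((g : Mat2) * Y * (g : Mat2)ᴴ) = mink X Y := by
  have h (Z : Mat2) : ((g : Mat2) * Z * (g : Mat2)ᴴ).det = Z.det := by
    simp [Matrix.det_mul, Matrix.det_conjTranspose]
  unfold mink
  rw [← add_mul, ← mul_add, h, h, h]

theorem mink_smul_one {Y : Mat2} (hY : Y.trace = 0) (c : ℂ) : mink (c • 1) Y = 0 := by
  rw [Matrix.trace_fin_two] at hY
  have hY' : Y 1 1 = -Y 0 0 := by linear_combination hY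
  simp [mink_eq, hY']

theorem mink_of_trace_zero {X Y : Mat2} (hX : X.trace = 0) (hY : Y.trace = 0) :
    mink X Y = (X * Y).trace.re / 2 := by
  rw [Matrix.trace_fin_two] at hX hY
  have hX' : X 1 1 = -X 0 0 := by linear_combination hX
  have hY' : Y 1 1 = -Y 0 0 := by linear_combination hY
  rw [mink_eq, Matrix.trace_fin_two, ← Complex.neg_re]
  congr 2
  simp only [Matrix.mul_apply, Fin.sum_univ_two, hX', hY']
  ring

theorem trace_sub_half_trace (X : Mat2) : (X - (X.trace / 2) • (1 : Mat2)).trace = 0 := by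
  rw [Matrix.trace_sub, Matrix.trace_smul, Matrix.trace_one]
  simp

/-- The frame is parallel along `g exp(tζ)`: the ambient derivative of the `𝔐`-component is a
multiple of `g g*`, which is orthogonal to every `g H₀ g*` with `H₀` traceless. The case of `X` with
nonzero trace includes `e₀`, so this also encodes that the slice is totally geodesic. -/
theorem connCoeff_eq_zero (g : SL2) (ζ : hermTraceless) (X : Mat2) (k : Fin 4) :
    connCoeff g (toSl2 ζ) X k = 0 := by
  set X₀ := X - (X.trace / 2) • (1 : Mat2) with hX₀
  set H := halfBasis k with hH
  set H₀ := H - (H.trace / 2) • (1 : Mat2) with hH₀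
  have h := hasDerivAt_congr_conj (minkLin ((2 : ℂ) • ((g : Mat2) * H₀ * (g : Mat2)ᴴ)))
    ((2 : ℂ) • X₀) g (toSl2 ζ)
  have e : minkLin ((2 : ℂ) • ((g : Mat2) * H₀ * (g : Mat2)ᴴ))
      ((g : Mat2) * (((toSl2 ζ : sl2) : Mat2) * ((2 : ℂ) • X₀)
        + ((2 : ℂ) • X₀) * ((toSl2 ζ : sl2) : Mat2)ᴴ) * (g : Mat2)ᴴ) = 0 := by
    have e1 : ((toSl2 ζ : sl2) : Mat2)ᴴ = (ζ : Mat2) := conjTranspose_coe ζ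
    have e2 : ((toSl2 ζ : sl2) : Mat2) = (ζ : Mat2) := rfl
    rw [e1, e2, mul_smul_comm, smul_mul_assoc, ← smul_add,
      mul_add_mul_eq_smul_one (trace_coe ζ) (trace_sub_half_trace X), smul_smul]
    change mink _ _ = 0
    have e3 : (2 : ℂ) • ((g : Mat2) * H₀ * (g : Mat2)ᴴ)
        = (g : Mat2) * ((2 : ℂ) • H₀) * (g : Mat2)ᴴ := by simp
    rw [e3, mink_conj, mink_smul_one]
    rw [Matrix.trace_smul, trace_sub_half_trace, smul_zero]
  rw [e] at h
  -- The component along `∂_s` is constant on the curve, so it only subtracts a constant from the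
  -- pairing.
  have h' := (h.sub_const (X.trace.re * (tangentVec g H).2)).deriv
  rw [← h']
  unfold connCoeff
  congr 1
  funext t
  simp only [ambForm, tangentVec]
  rw [← hH]
  change mink _ _ - _ = mink _ _ - _
  rw [← hX₀, ← hH₀]
  simp

theorem spinDeriv_eq (v : SL2 → Spinor) (g : SL2) (ζ : hermTraceless) :
    spinDeriv v g (toSl2 ζ) = dirDeriv v g (toSl2 ζ) := by
  simp [spinDeriv, connCoeff_eq_zero]

theorem formDeriv_eq (α : SL2 → hermTraceless → ℝ) (g : SL2) (ζ ξ : hermTraceless) :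
    formDeriv α g (toSl2 ζ) ξ = dirDeriv (fun g' => α g' ξ) g (toSl2 ζ) := by
  simp [formDeriv, connCoeff_eq_zero]

/-! ### Matrix identities -/

theorem coe_inv_conjT (g : SL2) :
    (((conjT g)⁻¹ : SL2) : Mat2) = ((g⁻¹ : SL2) : Mat2)ᴴ := by
  rw [Matrix.SpecialLinearGroup.coe_inv, Matrix.SpecialLinearGroup.coe_inv,
    Matrix.adjugate_conjTranspose]
  rfl

theorem coe_mul_coe_inv (g : SL2) : (g : Mat2) * ((g⁻¹ : SL2) : Mat2) = 1 := by
  rw [← Matrix.SpecialLinearGroup.coe_mul, mul_inv_cancel, Matrix.SpecialLinearGroup.coe_one]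

theorem coe_inv_mul_coe (g : SL2) : ((g⁻¹ : SL2) : Mat2) * (g : Mat2) = 1 := by
  rw [← Matrix.SpecialLinearGroup.coe_mul, inv_mul_cancel, Matrix.SpecialLinearGroup.coe_one]

theorem conjTranspose_mul_conjTranspose_inv (g : SL2) :
    (g : Mat2)ᴴ * ((g⁻¹ : SL2) : Mat2)ᴴ = 1 := by
  rw [← Matrix.conjTranspose_mul, coe_inv_mul_coe, Matrix.conjTranspose_one]

theorem conjTranspose_of_mem_SU2 {h : SL2} (hh : h ∈ SU2) :
    (h : Mat2)ᴴ = ((h⁻¹ : SL2) : Mat2) := by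
  have h1 : (h : Mat2)ᴴ * (h : Mat2) = 1 := Matrix.mem_unitaryGroup_iff'.1 hh
  calc (h : Mat2)ᴴ = (h : Mat2)ᴴ * ((h : Mat2) * ((h⁻¹ : SL2) : Mat2)) := by
        rw [coe_mul_coe_inv, mul_one]
    _ = _ := by rw [← mul_assoc, h1, one_mul]

theorem rho_inv_of_mem_SU2 {h : SL2} (hh : h ∈ SU2) (ψ : Spinor) :
    rho h⁻¹ ψ = (((h⁻¹ : SL2) : Mat2) *ᵥ ψ.1, ((h⁻¹ : SL2) : Mat2) *ᵥ ψ.2) := by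
  rw [rho, coe_inv_conjT, inv_inv, conjTranspose_of_mem_SU2 hh]

theorem star_mulVec_dotProduct_mulVec (M N : Mat2) (x y : C2) :
    star (M *ᵥ x) ⬝ᵥ (N *ᵥ y) = star x ⬝ᵥ ((Mᴴ * N) *ᵥ y) := by
  rw [Matrix.star_mulVec, ← Matrix.dotProduct_mulVec, Matrix.mulVec_mulVec]

theorem star_star_dotProduct_mulVec (M : Mat2) (x y : C2) :
    star (star x ⬝ᵥ (M *ᵥ y)) = star y ⬝ᵥ (Mᴴ *ᵥ x) := by
  rw [Matrix.star_dotProduct, star_star, Matrix.star_mulVec, Matrix.dotProduct_mulVec]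

/-! ### Killing spinors in terms of `g⁻¹ w` and `g* u` -/

theorem killingSpinor_apply (p : C2 × C2) (g : SL2) :
    killingSpinor p g =
      (((g⁻¹ : SL2) : Mat2) *ᵥ p.1 + (g : Mat2)ᴴ *ᵥ p.2,
        -Complex.I • (((g⁻¹ : SL2) : Mat2) *ᵥ p.1) + Complex.I • ((g : Mat2)ᴴ *ᵥ p.2)) := by
  simp [killingSpinor, sigmaInv, sigmaStar]

/-- Parallelogram law: the two halves have norms `|a + b|` and `|a - b|`, the factor `i` being
unimodular. -/
theorem hermProd_self_eq (a b : C2) :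
    hermProd (a + b, -Complex.I • a + Complex.I • b) (a + b, -Complex.I • a + Complex.I • b)
      = 2 * (star a ⬝ᵥ a + star b ⬝ᵥ b) := by
  have hI : Complex.I * Complex.I = -1 := Complex.I_mul_I
  simp [hermProd, dotProduct, Fin.sum_univ_two]
  linear_combination (-(a 0 - b 0) * (starRingEnd ℂ (a 0) - starRingEnd ℂ (b 0))
    - (a 1 - b 1) * (starRingEnd ℂ (a 1) - starRingEnd ℂ (b 1))) * hI

/-- Multiplication by `e₀` swaps the two halves, and `ξ` then acts as `2ξ` on one and `-2ξ` on the
other after the swap is undone. The result is the difference of the quadratic form `2ξ` at `a + b`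
and at `a - b`, so only cross terms survive. -/
theorem hermProd_cliff_cliff_self_eq (a b : C2) (ξ : hermTraceless) :
    hermProd (cliff ξ (cliff ((1 / 2 : ℂ) • (1 : Mat2))
        (a + b, -Complex.I • a + Complex.I • b))) (a + b, -Complex.I • a + Complex.I • b)
      = 4 * (star a ⬝ᵥ ((ξ : Mat2) *ᵥ b) + star b ⬝ᵥ ((ξ : Mat2) *ᵥ a)) := by
  have hI : Complex.I * Complex.I = -1 := Complex.I_mul_I
  have e : (ξ : Mat2).adjugate = -(ξ : Mat2) := adjugate_of_mem_sl2 ξ.2.2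
  have e1 : ((1 / 2 : ℂ) • (1 : Mat2)).adjugate = (1 / 2 : ℂ) • (1 : Mat2) := by
    ext i j
    fin_cases i <;> fin_cases j <;> simp [Matrix.adjugate_fin_two]
  simp only [cliff, e, e1, Matrix.smul_mulVec, Matrix.one_mulVec, smul_smul, hermProd, dotProduct,
    Fin.sum_univ_two, Matrix.mulVec, Pi.smul_apply, Pi.add_apply, Pi.star_apply, smul_eq_mul,
    star_add, star_mul, star_neg, RCLike.star_def, Complex.conj_I, Matrix.neg_apply]
  ring_nf
  simp only [Complex.I_sq]
  ring

theorem adjugate_basePoint (g : SL2) :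
    (basePoint g).adjugate = ((g⁻¹ : SL2) : Mat2)ᴴ * ((g⁻¹ : SL2) : Mat2) := by
  rw [basePoint, Matrix.adjugate_mul_distrib, ← Matrix.adjugate_conjTranspose,
    Matrix.SpecialLinearGroup.coe_inv]

/-- `V_{w⊕u}` extended to all matrices. -/
def VLin (p : C2 × C2) : Mat2 →ₗ[ℝ] ℝ where
  toFun W := (2 * (star p.1 ⬝ᵥ (W.adjugate *ᵥ p.1) + star p.2 ⬝ᵥ (W *ᵥ p.2))).re
  map_add' X Y := by
    have h : (X + Y).adjugate = X.adjugate + Y.adjugate := adjugateLin.map_add X Y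
    rw [h, Matrix.add_mulVec, Matrix.add_mulVec, dotProduct_add, dotProduct_add, ← Complex.add_re]
    congr 1
    ring
  map_smul' c X := by
    have h : (c • X).adjugate = c • X.adjugate := adjugateLin.map_smul c X
    rw [h, Matrix.smul_mulVec, Matrix.smul_mulVec, dotProduct_smul, dotProduct_smul, ← smul_add,
      mul_smul_comm, Complex.smul_re]
    rfl

/-- `α_{w⊕u}` extended to all matrices. -/
def alphaLin (p : C2 × C2) : Mat2 →ₗ[ℝ] ℝ where
  toFun ξ := (2 * (star p.1 ⬝ᵥ (ξ *ᵥ p.2) + star p.2 ⬝ᵥ (ξᴴ *ᵥ p.1))).re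
  map_add' X Y := by
    rw [Matrix.conjTranspose_add, Matrix.add_mulVec, Matrix.add_mulVec, dotProduct_add,
      dotProduct_add, ← Complex.add_re]
    congr 1
    ring
  map_smul' c X := by
    rw [Matrix.conjTranspose_smul, star_trivial c, Matrix.smul_mulVec, Matrix.smul_mulVec,
      dotProduct_smul, dotProduct_smul, ← smul_add, mul_smul_comm, Complex.smul_re]
    rfl

/-- Conjugation exchanges the two summands, whatever the matrix `ξ`. -/
theorem ofReal_alphaLin (p : C2 × C2) (ξ : Mat2) :
    ((alphaLin p ξ : ℝ) : ℂ) = 2 * (star p.1 ⬝ᵥ (ξ *ᵥ p.2) + star p.2 ⬝ᵥ (ξᴴ *ᵥ p.1)) := by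
  apply Complex.conj_eq_iff_re.1
  rw [map_mul, map_add, ← RCLike.star_def, star_star_dotProduct_mulVec,
    star_star_dotProduct_mulVec, Matrix.conjTranspose_conjTranspose, add_comm]
  simp

theorem ofReal_VForm (p : C2 × C2) (W : herm2) :
    ((VForm p W : ℝ) : ℂ) = 2 * (star p.1 ⬝ᵥ ((W : Mat2).adjugate *ᵥ p.1)
      + star p.2 ⬝ᵥ ((W : Mat2) *ᵥ p.2)) := by
  have hW : (W : Mat2)ᴴ = W := W.2
  apply Complex.conj_eq_iff_re.1
  rw [map_mul, map_add, ← RCLike.star_def, star_star_dotProduct_mulVec,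
    star_star_dotProduct_mulVec, Matrix.adjugate_conjTranspose, hW]
  simp

theorem normFun_killingSpinor (p : C2 × C2) (g : SL2) :
    normFun (killingSpinor p) g = VLin p (basePoint g) := by
  rw [normFun, killingSpinor_apply, hermProd_self_eq, star_mulVec_dotProduct_mulVec,
    star_mulVec_dotProduct_mulVec, Matrix.conjTranspose_conjTranspose, ← adjugate_basePoint]
  rfl

theorem currentC_killingSpinor (p : C2 × C2) (g : SL2) (ξ : hermTraceless) :
    currentC (killingSpinor p) g ξ
      = alphaLin p (((g⁻¹ : SL2) : Mat2)ᴴ * ((2 : ℝ) • (ξ : Mat2)) * (g : Mat2)ᴴ) := by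
  rw [ofReal_alphaLin, currentC, killingSpinor_apply, hermProd_cliff_cliff_self_eq,
    Matrix.mulVec_mulVec, Matrix.mulVec_mulVec, star_mulVec_dotProduct_mulVec,
    star_mulVec_dotProduct_mulVec]
  simp only [Matrix.conjTranspose_mul, Matrix.conjTranspose_conjTranspose, conjTranspose_coe,
    mul_smul_comm, smul_mul_assoc, Matrix.smul_mulVec, dotProduct_smul, Matrix.conjTranspose_smul,
    star_trivial, mul_assoc, Complex.real_smul]
  push_cast
  ring

theorem current_killingSpinor (p : C2 × C2) (g : SL2) (ξ : hermTraceless) :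
    current (killingSpinor p) g ξ
      = alphaLin p (((g⁻¹ : SL2) : Mat2)ᴴ * ((2 : ℝ) • (ξ : Mat2)) * (g : Mat2)ᴴ) := by
  rw [current, currentC_killingSpinor, Complex.ofReal_re]

/-! ### Smoothness -/

@[fun_prop]
theorem _root_.ContDiff.complex_conj {E : Type*} [NormedAddCommGroup E] [NormedSpace ℝ E]
    {n : WithTop ℕ∞} {f : E → ℂ} (hf : ContDiff ℝ n f) :
    ContDiff ℝ n (fun x => starRingEnd ℂ (f x)) :=
  Complex.conjCLE.contDiff.comp hf

@[fun_prop]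
theorem _root_.ContDiff.complex_re {E : Type*} [NormedAddCommGroup E] [NormedSpace ℝ E]
    {n : WithTop ℕ∞} {f : E → ℂ} (hf : ContDiff ℝ n f) :
    ContDiff ℝ n (fun x => (f x).re) :=
  Complex.reCLM.contDiff.comp hf

theorem IsSmooth.comp {E F : Type*} [NormedAddCommGroup E] [NormedSpace ℝ E]
    [NormedAddCommGroup F] [NormedSpace ℝ F] {G : E → F} (hG : ContDiff ℝ ∞ G) {f : SL2 → E}
    (hf : IsSmooth f) : IsSmooth (fun g => G (f g)) := by
  obtain ⟨F, hF, h⟩ := hf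
  exact ⟨fun e => G (F e), hG.comp hF, fun g => congrArg G (h g)⟩

theorem isSmooth_killingSpinor (p : C2 × C2) : IsSmooth (killingSpinor p) := by
  -- The adjugate replaces the inverse because `IsSmooth` asks for an extension to all matrices.
  let a : (Fin 2 → Fin 2 → ℂ) → C2 := fun e => (Matrix.of e).adjugate *ᵥ p.1
  let b : (Fin 2 → Fin 2 → ℂ) → C2 := fun e => (Matrix.of e)ᴴ *ᵥ p.2
  have ha : ContDiff ℝ ∞ a := by
    refine contDiff_pi.2 fun i => ?_
    fin_cases i <;> simp [a, Matrix.adjugate_fin_two, Matrix.vecHead, Matrix.vecTail] <;> fun_prop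
  have hb : ContDiff ℝ ∞ b := by
    refine contDiff_pi.2 fun i => ?_
    fin_cases i <;> simp [b] <;> fun_prop
  refine ⟨fun e => (a e + b e, -Complex.I • a e + Complex.I • b e),
    (ha.add hb).prodMk ((ha.const_smul _).add (hb.const_smul _)), fun g => ?_⟩
  rw [killingSpinor_apply, Matrix.SpecialLinearGroup.coe_inv]
  rfl

theorem contDiff_hermProd_self : ContDiff ℝ ∞ (fun s : Spinor => (hermProd s s).re) := by
  simp only [hermProd, dotProduct, Fin.sum_univ_two, Pi.star_apply, RCLike.star_def]
  fun_prop

theorem contDiff_hermProd_cliff_self (X Y : Mat2) :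
    ContDiff ℝ ∞ (fun s : Spinor => (hermProd (cliff X (cliff Y s)) s).re) := by
  simp only [hermProd, cliff, dotProduct, Fin.sum_univ_two, Pi.star_apply, RCLike.star_def,
    Matrix.mulVec, Pi.smul_apply, smul_eq_mul]
  fun_prop

/-! ### Killing spinors -/

theorem isSpinorField_killingSpinor (p : C2 × C2) : IsSpinorField (killingSpinor p) := by
  refine ⟨isSmooth_killingSpinor p, fun g h hh => ?_⟩
  rw [rho_inv_of_mem_SU2 hh, killingSpinor_apply, killingSpinor_apply, mul_inv_rev,
    Matrix.SpecialLinearGroup.coe_mul, Matrix.SpecialLinearGroup.coe_mul,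
    Matrix.conjTranspose_mul, conjTranspose_of_mem_SU2 hh]
  simp only [Matrix.mulVec_add, Matrix.mulVec_smul, Matrix.mulVec_mulVec]

theorem killingSpinor_mem_IKS (p : C2 × C2) : killingSpinor p ∈ IKS := by
  refine ⟨isSpinorField_killingSpinor p, fun g ζ => ?_⟩
  have ha := hasDerivAt_inv_mulVec g (toSl2 ζ) p.1
  have hb := hasDerivAt_conjTranspose_mulVec g (toSl2 ζ) p.2
  have e1 : ((toSl2 ζ : sl2) : Mat2)ᴴ = (ζ : Mat2) := conjTranspose_coe ζ
  have e2 : ((toSl2 ζ : sl2) : Mat2) = (ζ : Mat2) := rfl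
  rw [e1] at hb
  rw [e2] at ha
  have h := (ha.add hb).prodMk
    ((ha.const_smul (-Complex.I)).add (hb.const_smul Complex.I))
  have hf : (fun t : ℝ => killingSpinor p (g * expSL (t • toSl2 ζ))) = fun t : ℝ => _ :=
    funext fun t => killingSpinor_apply p _
  rw [spinDeriv_eq, dirDeriv, hf]
  refine (congrArg (· + _) h.deriv).trans ?_
  rw [ killingSpinor_apply, cliff, adjugate_of_mem_sl2 ζ.2.2]
  have hI : Complex.I * Complex.I = -1 := Complex.I_mul_I
  simp only [Matrix.mulVec_add, Matrix.mulVec_smul, Matrix.neg_mulVec]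
  generalize (ζ : Mat2) *ᵥ (((g⁻¹ : SL2) : Mat2) *ᵥ p.1) = a
  generalize (ζ : Mat2) *ᵥ ((g : Mat2)ᴴ *ᵥ p.2) = b
  ext i
  · simp
    linear_combination (b i - a i) * hI
  · simp
    ring

/-! ### Integration of the Killing equation -/

section

attribute [local instance] Matrix.linftyOpNormedAddCommGroup Matrix.linftyOpNormedSpace
  Matrix.linftyOpNormedRing Matrix.linftyOpNormedAlgebra

theorem hasDerivAt_mulVec {M : ℝ → Mat2} {M' : Mat2} {x : ℝ → C2} {x' : C2} {t : ℝ}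
    (hM : HasDerivAt M M' t) (hx : HasDerivAt x x' t) :
    HasDerivAt (fun s => M s *ᵥ x s) (M' *ᵥ x t + M t *ᵥ x') t := by
  have h : ∀ i j, HasDerivAt (fun s => M s i j) (M' i j) t := fun i j =>
    hM.linearMap_comp (Matrix.entryLinearMap ℝ ℂ i j)
  have h' := hasDerivAt_pi.1 hx
  refine hasDerivAt_pi.2 fun i => ?_
  have := ((h i 0).mul (h' 0)).add ((h i 1).mul (h' 1))
  refine (this.congr_deriv ?_).congr_of_eventuallyEq (Filter.Eventually.of_forall fun s => ?_)
  · simp only [Pi.add_apply, Matrix.mulVec_eq_sum, Fin.sum_univ_two, Pi.smul_apply,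
      Matrix.transpose_apply, MulOpposite.smul_eq_mul_unop, MulOpposite.unop_op]
    ring
  · simp only [Pi.add_apply, Pi.mul_apply, Matrix.mulVec_eq_sum, Fin.sum_univ_two, Pi.smul_apply,
      Matrix.transpose_apply, MulOpposite.smul_eq_mul_unop, MulOpposite.unop_op]

/-- If `f` has derivative `-ζ f` along `ζ`, then `g f(g)` has derivative zero. -/
theorem hasDerivAt_mul_expSL_mulVec_zero {f : SL2 → C2} {g : SL2} {ζ : hermTraceless}
    (hf : HasDerivAt (fun t : ℝ => f (g * expSL (t • toSl2 ζ))) (-((ζ : Mat2) *ᵥ f g)) 0) :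
    HasDerivAt (fun t : ℝ => ((g * expSL (t • toSl2 ζ) : SL2) : Mat2)
      *ᵥ f (g * expSL (t • toSl2 ζ))) 0 0 := by
  refine (hasDerivAt_mulVec (hasDerivAt_mul_expSL g (toSl2 ζ)) hf).congr_deriv ?_
  have e2 : ((toSl2 ζ : sl2) : Mat2) = (ζ : Mat2) := rfl
  rw [zero_smul, expSL_zero, mul_one, Matrix.mulVec_neg, Matrix.mulVec_mulVec, e2, add_neg_cancel]

/-- If `f` has derivative `ζ f` along `ζ`, then `(g*)⁻¹ f(g)` has derivative zero. -/
theorem hasDerivAt_conjTranspose_inv_mulVec_zero {f : SL2 → C2} {g : SL2} {ζ : hermTraceless}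
    (hf : HasDerivAt (fun t : ℝ => f (g * expSL (t • toSl2 ζ))) ((ζ : Mat2) *ᵥ f g) 0) :
    HasDerivAt (fun t : ℝ => (((g * expSL (t • toSl2 ζ))⁻¹ : SL2) : Mat2)ᴴ
      *ᵥ f (g * expSL (t • toSl2 ζ))) 0 0 := by
  have h := (hasDerivAt_mul_expSL_inv g (toSl2 ζ)).linearMap_comp
    (Matrix.conjTransposeLinearEquiv (Fin 2) (Fin 2) ℝ ℂ).toLinearMap
  refine (hasDerivAt_mulVec h hf).congr_deriv ?_
  have e1 : ((toSl2 ζ : sl2) : Mat2)ᴴ = (ζ : Mat2) := conjTranspose_coe ζ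
  change (-(((toSl2 ζ : sl2) : Mat2) * ((g⁻¹ : SL2) : Mat2)))ᴴ *ᵥ _
    + (((g * expSL ((0 : ℝ) • toSl2 ζ))⁻¹ : SL2) : Mat2)ᴴ *ᵥ _ = 0
  rw [zero_smul, expSL_zero, mul_one, Matrix.conjTranspose_neg, Matrix.conjTranspose_mul, e1,
    Matrix.neg_mulVec, Matrix.mulVec_mulVec, neg_add_cancel]

end

/-- The combinations `P` and `Q` decouple the equation, and `hP`, `hQ` integrate them. Elements of
`SU2` act alike on both halves of a spinor, so `P` and `Q` inherit the equivariance of `v`. -/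
theorem exists_killingSpinor_of_mem_IKS {v : SL2 → Spinor} (hv : v ∈ IKS) :
    ∃ p, v = killingSpinor p := by
  obtain ⟨⟨hsm, hinv⟩, hode⟩ := hv
  have hder : ∀ g (ζ : hermTraceless), HasDerivAt (fun t : ℝ => v (g * expSL (t • toSl2 ζ)))
      (-((Complex.I / 2) • cliff ζ (v g))) 0 := by
    intro g ζ
    have h := hode g ζ
    rw [spinDeriv_eq] at h
    rw [← eq_neg_of_add_eq_zero_left h]
    exact hsm.hasDerivAt g (toSl2 ζ)
  have hI : Complex.I * Complex.I = -1 := Complex.I_mul_I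
  let P : SL2 → C2 := fun g => (v g).1 + Complex.I • (v g).2
  let Q : SL2 → C2 := fun g => (v g).1 - Complex.I • (v g).2
  have hP : ∀ g : SL2, (g : Mat2) *ᵥ P g = ((1 : SL2) : Mat2) *ᵥ P 1 := by
    refine eq_of_invariant_of_hasDerivAt_zero (f := fun g => (g : Mat2) *ᵥ P g) ?_ ?_
    · intro g h hh
      simp only [P, hinv g h hh, rho_inv_of_mem_SU2 hh]
      rw [← Matrix.mulVec_smul, ← Matrix.mulVec_add, Matrix.mulVec_mulVec,
        Matrix.SpecialLinearGroup.coe_mul, mul_assoc, coe_mul_coe_inv, mul_one]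
    · intro g ζ
      apply hasDerivAt_mul_expSL_mulVec_zero
      have h := hder g ζ
      have h1 := h.linearMap_comp (LinearMap.fst ℝ C2 C2)
      have h2 := (h.linearMap_comp (LinearMap.snd ℝ C2 C2)).const_smul Complex.I
      refine (h1.add h2).congr_deriv ?_
      simp only [P, cliff, adjugate_of_mem_sl2 ζ.2.2, Matrix.mulVec_add, Matrix.mulVec_smul,
        Matrix.neg_mulVec, LinearMap.fst_apply, LinearMap.snd_apply, Prod.fst_neg, Prod.snd_neg,
        Prod.smul_fst, Prod.smul_snd]
      generalize (ζ : Mat2) *ᵥ (v g).1 = a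
      generalize (ζ : Mat2) *ᵥ (v g).2 = b
      ext i
      simp
      linear_combination a i * hI
  have hQ : ∀ g, ((g⁻¹ : SL2) : Mat2)ᴴ *ᵥ Q g = (((1 : SL2)⁻¹ : SL2) : Mat2)ᴴ *ᵥ Q 1 := by
    refine eq_of_invariant_of_hasDerivAt_zero (f := fun g => ((g⁻¹ : SL2) : Mat2)ᴴ *ᵥ Q g) ?_ ?_
    · intro g h hh
      simp only [Q, hinv g h hh, rho_inv_of_mem_SU2 hh]
      rw [← Matrix.mulVec_smul, ← Matrix.mulVec_sub, Matrix.mulVec_mulVec, mul_inv_rev,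
        Matrix.SpecialLinearGroup.coe_mul, Matrix.conjTranspose_mul, mul_assoc,
        ← conjTranspose_of_mem_SU2 hh, Matrix.conjTranspose_conjTranspose,
        conjTranspose_of_mem_SU2 hh, coe_mul_coe_inv, mul_one]
    · intro g ζ
      apply hasDerivAt_conjTranspose_inv_mulVec_zero
      have h := hder g ζ
      have h1 := h.linearMap_comp (LinearMap.fst ℝ C2 C2)
      have h2 := (h.linearMap_comp (LinearMap.snd ℝ C2 C2)).const_smul Complex.I
      refine (h1.sub h2).congr_deriv ?_
      simp only [Q, cliff, adjugate_of_mem_sl2 ζ.2.2, Matrix.mulVec_sub, Matrix.mulVec_smul,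
        Matrix.neg_mulVec, LinearMap.fst_apply, LinearMap.snd_apply, Prod.fst_neg, Prod.snd_neg,
        Prod.smul_fst, Prod.smul_snd]
      generalize (ζ : Mat2) *ᵥ (v g).1 = a
      generalize (ζ : Mat2) *ᵥ (v g).2 = b
      ext i
      simp
      linear_combination -a i * hI
  -- For `killingSpinor (w, u)` one finds `P 1 = 2w` and `Q 1 = 2u`, whence the halves.
  refine ⟨((1 / 2 : ℂ) • P 1, (1 / 2 : ℂ) • Q 1), funext fun g => ?_⟩
  have hP' : ((g⁻¹ : SL2) : Mat2) *ᵥ P 1 = P g := by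
    have h := hP g
    rw [Matrix.SpecialLinearGroup.coe_one, Matrix.one_mulVec] at h
    rw [← h, Matrix.mulVec_mulVec, coe_inv_mul_coe, Matrix.one_mulVec]
  have hQ' : (g : Mat2)ᴴ *ᵥ Q 1 = Q g := by
    have h := hQ g
    rw [inv_one, Matrix.SpecialLinearGroup.coe_one, Matrix.conjTranspose_one,
      Matrix.one_mulVec] at h
    rw [← h, Matrix.mulVec_mulVec, conjTranspose_mul_conjTranspose_inv, Matrix.one_mulVec]
  rw [killingSpinor_apply]
  simp only [Matrix.mulVec_smul, hP', hQ']
  ext i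
  · simp [P, Q]
    ring
  · simp [P, Q]
    linear_combination (v g).2 i * hI

/-- The parametrization `w ⊕ u ↦ σ_{w⊕u}` as a linear map. -/
def killingSpinorLin : (C2 × C2) →ₗ[ℂ] (SL2 → Spinor) where
  toFun := killingSpinor
  map_add' p q := by
    funext g
    simp only [killingSpinor_apply, Pi.add_apply, Prod.fst_add, Prod.snd_add, Matrix.mulVec_add,
      Prod.mk_add_mk, Prod.mk.injEq]
    constructor <;> module
  map_smul' c p := by
    funext g
    simp only [killingSpinor_apply, Pi.smul_apply, Prod.smul_fst, Prod.smul_snd,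
      Matrix.mulVec_smul, Prod.smul_mk, RingHom.id_apply, Prod.mk.injEq]
    constructor <;> module

theorem killingSpinorLin_injective : Function.Injective killingSpinorLin := by
  rw [injective_iff_map_eq_zero]
  intro p hp
  have h : killingSpinor p 1 = 0 := congrFun hp 1
  have hI : Complex.I * Complex.I = -1 := Complex.I_mul_I
  rw [killingSpinor_apply, inv_one, Matrix.SpecialLinearGroup.coe_one, Matrix.conjTranspose_one,
    Matrix.one_mulVec, Matrix.one_mulVec, Prod.mk_eq_zero] at h
  have h1 := fun i => congrFun h.1 i
  have h2 := fun i => congrFun h.2 i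
  simp only [Pi.add_apply, Pi.smul_apply, Pi.zero_apply, smul_eq_mul] at h1 h2
  ext i
  · change p.1 i = 0
    linear_combination (1 / 2) * h1 i + (Complex.I / 2) * h2 i
      + ((p.1 i - p.2 i) / 2) * hI
  · change p.2 i = 0
    linear_combination (1 / 2) * h1 i - (Complex.I / 2) * h2 i
      - ((p.1 i - p.2 i) / 2) * hI

theorem range_killingSpinorLin :
    LinearMap.range killingSpinorLin = Submodule.span ℂ generators := by
  have hw (w : C2) : killingSpinor (w, 0) = sigmaInv w ![1, -Complex.I] := by
    funext g
    simp [killingSpinor, sigmaStar, Prod.ext_iff]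
  have hu (u : C2) : killingSpinor (0, u) = sigmaStar u ![1, Complex.I] := by
    funext g
    simp [killingSpinor, sigmaInv, Prod.ext_iff]
  apply le_antisymm
  · rintro _ ⟨p, rfl⟩
    exact Submodule.add_mem _ (Submodule.subset_span ⟨p.1, Or.inl rfl⟩)
      (Submodule.subset_span ⟨p.2, Or.inr rfl⟩)
  · rw [Submodule.span_le]
    rintro _ ⟨w, rfl | rfl⟩
    · exact ⟨(w, 0), hw w⟩
    · exact ⟨(0, w), hu w⟩

theorem IKS_eq_span : IKS = (Submodule.span ℂ generators : Set (SL2 → Spinor)) := by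
  rw [← range_killingSpinorLin]
  ext v
  constructor
  · intro hv
    obtain ⟨p, rfl⟩ := exists_killingSpinor_of_mem_IKS hv
    exact ⟨p, rfl⟩
  · rintro ⟨p, rfl⟩
    exact killingSpinor_mem_IKS p

/-- The parametrization of the space of imaginary Killing spinors by `ℂ² ⊕ ℂ²`. -/
def killingSpinorEquiv : (C2 × C2) ≃ₗ[ℂ] Submodule.span ℂ generators :=
  (LinearEquiv.ofInjective killingSpinorLin killingSpinorLin_injective).trans
    (LinearEquiv.ofEq _ _ range_killingSpinorLin)

theorem finrank_span_generators : Module.finrank ℂ (Submodule.span ℂ generators) = 4 := by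
  rw [← killingSpinorEquiv.finrank_eq]
  simp

/-! ### The function `V_σ` -/

theorem isSmooth_normFun (p : C2 × C2) : IsSmooth (normFun (killingSpinor p)) :=
  (isSmooth_killingSpinor p).comp contDiff_hermProd_self

theorem basePoint_mul_of_mem_SU2 (g : SL2) {h : SL2} (hh : h ∈ SU2) :
    basePoint (g * h) = basePoint g := by
  have h1 : (h : Mat2) * (h : Mat2)ᴴ = 1 := Matrix.mem_unitaryGroup_iff.1 hh
  rw [basePoint, basePoint, Matrix.SpecialLinearGroup.coe_mul, Matrix.conjTranspose_mul]
  calc (g : Mat2) * (h : Mat2) * ((h : Mat2)ᴴ * (g : Mat2)ᴴ)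
      = (g : Mat2) * ((h : Mat2) * (h : Mat2)ᴴ) * (g : Mat2)ᴴ := by simp only [mul_assoc]
    _ = _ := by rw [h1, mul_one]

theorem dirDeriv_congr_conj (L : Mat2 →ₗ[ℝ] ℝ) (M : Mat2) (g : SL2) (ζ : hermTraceless) :
    dirDeriv (fun g' : SL2 => L ((g' : Mat2) * M * (g' : Mat2)ᴴ)) g (toSl2 ζ)
      = L ((g : Mat2) * ((ζ : Mat2) * M + M * (ζ : Mat2)) * (g : Mat2)ᴴ) := by
  have h := (hasDerivAt_congr_conj L M g (toSl2 ζ)).deriv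
  have e1 : ((toSl2 ζ : sl2) : Mat2)ᴴ = (ζ : Mat2) := conjTranspose_coe ζ
  rw [e1] at h
  exact h

theorem dirDeriv_conj_conjT (L : Mat2 →ₗ[ℝ] ℝ) (M : Mat2) (g : SL2) (ζ : hermTraceless) :
    dirDeriv (fun g' : SL2 => L (((g'⁻¹ : SL2) : Mat2)ᴴ * M * (g' : Mat2)ᴴ)) g (toSl2 ζ)
      = L (((g⁻¹ : SL2) : Mat2)ᴴ * (M * (ζ : Mat2) - (ζ : Mat2) * M) * (g : Mat2)ᴴ) := by
  have h := (hasDerivAt_conj_conjT L M g (toSl2 ζ)).deriv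
  have e1 : ((toSl2 ζ : sl2) : Mat2)ᴴ = (ζ : Mat2) := conjTranspose_coe ζ
  rw [e1] at h
  exact h

theorem trace_mul_eq_ofReal (η ξ : hermTraceless) :
    ((η : Mat2) * (ξ : Mat2)).trace = (((η : Mat2) * (ξ : Mat2)).trace.re : ℂ) := by
  symm
  apply Complex.conj_eq_iff_re.1
  rw [← RCLike.star_def, ← Matrix.trace_conjTranspose, Matrix.conjTranspose_mul,
    conjTranspose_coe, conjTranspose_coe, Matrix.trace_mul_comm]

theorem ambForm_tangentVec (g : SL2) (η ξ : hermTraceless) :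
    ambForm (tangentVec g η) (tangentVec g ξ) = 2 * ((η : Mat2) * (ξ : Mat2)).trace.re := by
  have e (ζ : hermTraceless) : tangentVec g ζ
      = ((g : Mat2) * ((2 : ℂ) • (ζ : Mat2)) * (g : Mat2)ᴴ, 0) := by
    simp [tangentVec, trace_coe]
  rw [ambForm, e, e, mink_conj, mink_of_trace_zero]
  · simp [smul_smul, Matrix.trace_smul]
    ring
  · rw [Matrix.trace_smul, trace_coe, smul_zero]
  · rw [Matrix.trace_smul, trace_coe, smul_zero]

/-- For a linear form `L` in `g g*`, the differential on `ξ` is `L(2 g ξ g*)`. Differentiating again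
along `η` produces `2(ηξ + ξη) = 2 tr(ηξ) I`, where `2 tr(ηξ)` is the metric. -/
theorem normFun_killingSpinor_mem_Nb (p : C2 × C2) : normFun (killingSpinor p) ∈ Nb := by
  refine ⟨isSmooth_normFun p, fun g h hh => ?_, fun g η ξ => ?_⟩
  · rw [normFun_killingSpinor, normFun_killingSpinor, basePoint_mul_of_mem_SU2 g hh]
  · have hf : normFun (killingSpinor p)
        = fun g' : SL2 => VLin p ((g' : Mat2) * 1 * (g' : Mat2)ᴴ) := by
      funext g'
      rw [normFun_killingSpinor, mul_one]
      rfl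
    have hd : (fun g' => differential (normFun (killingSpinor p)) g' ξ)
        = fun g' : SL2 => VLin p ((g' : Mat2) * ((2 : ℝ) • (ξ : Mat2)) * (g' : Mat2)ᴴ) := by
      funext g'
      rw [differential, hf, dirDeriv_congr_conj, one_mul, mul_one, two_smul]
    rw [formDeriv_eq, hd, dirDeriv_congr_conj, mul_smul_comm, smul_mul_assoc, ← smul_add,
      mul_add_mul_eq_smul_one (trace_coe η) (trace_coe ξ), trace_mul_eq_ofReal,
      ambForm_tangentVec, normFun_killingSpinor, Complex.coe_smul, smul_smul, mul_smul_comm,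
      smul_mul_assoc, map_smul, mul_one, smul_eq_mul, mul_comm]
    rfl

theorem isCausal_normFun_killingSpinor (p : C2 × C2) :
    IsCausal (normFun (killingSpinor p)) := by
  obtain ⟨w, u⟩ := p
  -- These are the coefficients of `V_{w⊕u}(Λ(y))`. The terms in `w` and those in `u` form null
  -- vectors with nonnegative time component.
  refine ⟨![2 * (Complex.normSq (w 0) + Complex.normSq (w 1)
        + Complex.normSq (u 0) + Complex.normSq (u 1)),
      2 * (Complex.normSq (w 1) - Complex.normSq (w 0)
        + Complex.normSq (u 0) - Complex.normSq (u 1)),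
      4 * ((u 0 * starRingEnd ℂ (u 1)).re - (w 0 * starRingEnd ℂ (w 1)).re),
      4 * ((u 0 * starRingEnd ℂ (u 1)).im - (w 0 * starRingEnd ℂ (w 1)).im)], ?_, ?_⟩
  -- The Minkowski square of the sum of the two null vectors is `-16 |w* u|²`.
  · have h := Complex.normSq_nonneg (starRingEnd ℂ (w 0) * u 0 + starRingEnd ℂ (w 1) * u 1)
    simp only [Complex.normSq_apply, Matrix.cons_val, Complex.mul_re, Complex.mul_im,
      Complex.conj_re, Complex.conj_im, Complex.add_re, Complex.add_im] at h ⊢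
    linarith
  · intro g x hx
    rw [normFun_killingSpinor, ← hx]
    simp [VLin, lam, Matrix.adjugate_fin_two, Fin.sum_univ_four, Complex.normSq_apply,
      dotProduct, Fin.sum_univ_two]
    ring

/-! ### The 1-form `α_σ` -/

theorem isOneForm_current_killingSpinor (p : C2 × C2) :
    IsOneForm (current (killingSpinor p)) := by
  refine ⟨fun g => ⟨fun ξ ξ' => ?_, fun c ξ => ?_⟩, fun ξ => ?_, fun g h hh ξ ξ' hξ => ?_⟩
  · simp only [current_killingSpinor, Submodule.coe_add, smul_add, mul_add, add_mul, map_add]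
  · simp only [current_killingSpinor, Submodule.coe_smul, mul_smul_comm, smul_mul_assoc, map_smul]
    rw [smul_comm]
  · exact (isSmooth_killingSpinor p).comp (contDiff_hermProd_cliff_self _ _)
  · rw [current_killingSpinor, current_killingSpinor, hξ, mul_inv_rev,
      Matrix.SpecialLinearGroup.coe_mul, Matrix.SpecialLinearGroup.coe_mul,
      Matrix.conjTranspose_mul, Matrix.conjTranspose_mul, ← conjTranspose_of_mem_SU2 hh,
      Matrix.conjTranspose_conjTranspose]
    simp only [mul_assoc, mul_smul_comm, smul_mul_assoc]

/-- Differentiating the conjugation `(g*)⁻¹ ξ g*` yields a commutator, antisymmetric in `η` and `ξ`;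
this is the Killing property. -/
theorem formDeriv_current_killingSpinor (p : C2 × C2) (g : SL2) (η ξ : hermTraceless) :
    formDeriv (current (killingSpinor p)) g (toSl2 η) ξ
      = 2 * alphaLin p (((g⁻¹ : SL2) : Mat2)ᴴ
          * ((ξ : Mat2) * (η : Mat2) - (η : Mat2) * (ξ : Mat2)) * (g : Mat2)ᴴ) := by
  simp only [formDeriv_eq, current_killingSpinor, dirDeriv_conj_conjT]
  rw [smul_mul_assoc, mul_smul_comm, ← smul_sub, mul_smul_comm, smul_mul_assoc, map_smul,
    smul_eq_mul]

theorem isKillingForm_current_killingSpinor (p : C2 × C2) :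
    IsKillingForm (current (killingSpinor p)) := by
  refine ⟨isOneForm_current_killingSpinor p, fun g η ξ => ?_⟩
  rw [formDeriv_current_killingSpinor, formDeriv_current_killingSpinor, ← mul_add, ← map_add,
    ← add_mul, ← mul_add]
  simp

theorem current_killingSpinor_half (p : C2 × C2) (g : SL2) (ξ : hermTraceless) :
    current (killingSpinor p) g ((1 / 2 : ℝ) • ξ)
      = alphaForm p (adj (conjT g)⁻¹ (toSl2 ξ)) := by
  rw [current_killingSpinor, Submodule.coe_smul, smul_smul]
  norm_num
  change _ = alphaLin p ((((conjT g)⁻¹ : SL2) : Mat2) * (ξ : Mat2)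
    * ((((conjT g)⁻¹)⁻¹ : SL2) : Mat2))
  rw [inv_inv, coe_inv_conjT]
  rfl

/-- The two halves in `X^η` and `X^ξ` against the factor 2 of `formDeriv_current_killingSpinor`
leave `1/2`, cleared here by the leading 2. -/
theorem formDeriv_current_killingSpinor_one (p : C2 × C2) (η ξ : hermTraceless) :
    2 * formDeriv (current (killingSpinor p)) 1 (toSl2 ((1 / 2 : ℝ) • η)) ((1 / 2 : ℝ) • ξ)
      = alphaLin p ((ξ : Mat2) * (η : Mat2) - (η : Mat2) * (ξ : Mat2)) := by
  rw [formDeriv_current_killingSpinor, inv_one, Matrix.SpecialLinearGroup.coe_one,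
    Matrix.conjTranspose_one, one_mul, mul_one]
  simp only [Submodule.coe_smul, smul_mul_assoc, mul_smul_comm, ← smul_sub, map_smul, smul_eq_mul]
  ring

theorem ofReal_formDeriv_current_killingSpinor_one (p : C2 × C2) (η ξ : hermTraceless) :
    ((formDeriv (current (killingSpinor p)) 1 (toSl2 ((1 / 2 : ℝ) • η)) ((1 / 2 : ℝ) • ξ) : ℝ) : ℂ)
      = star p.1 ⬝ᵥ (((ξ : Mat2) * (η : Mat2) - (η : Mat2) * (ξ : Mat2)) *ᵥ p.2)
        - star p.2 ⬝ᵥ (((ξ : Mat2) * (η : Mat2) - (η : Mat2) * (ξ : Mat2)) *ᵥ p.1) := by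
  have h := congrArg (fun x : ℝ => (x : ℂ)) (formDeriv_current_killingSpinor_one p η ξ)
  -- The commutator of Hermitian matrices is skew-Hermitian, which gives the minus sign before the
  -- `u`-term.
  have e : ((ξ : Mat2) * (η : Mat2) - (η : Mat2) * (ξ : Mat2))ᴴ
      = -((ξ : Mat2) * (η : Mat2) - (η : Mat2) * (ξ : Mat2)) := by
    simp only [Matrix.conjTranspose_sub, Matrix.conjTranspose_mul, conjTranspose_coe, neg_sub]
  simp only [ofReal_alphaLin, e, Matrix.neg_mulVec, dotProduct_neg] at h
  push_cast at h
  linear_combination h / 2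

/-! ### Equivariance -/

/-- It amounts to `(e⁻¹g)⁻¹ w = g⁻¹(e w)` and `(e⁻¹g)* u = g*((e*)⁻¹ u)`. -/
theorem actField_killingSpinor (e : SL2) (p : C2 × C2) :
    actField e (killingSpinor p) = killingSpinor (actPair e p) := by
  funext g
  rw [actField, killingSpinor_apply, killingSpinor_apply, actPair, coe_inv_conjT, mul_inv_rev,
    inv_inv, Matrix.SpecialLinearGroup.coe_mul, Matrix.SpecialLinearGroup.coe_mul,
    Matrix.conjTranspose_mul]
  simp only [Matrix.mulVec_mulVec]

theorem VForm_actPair (e : SL2) (p : C2 × C2) (W : herm2) :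
    VForm (actPair e p) W = VForm p (mu e⁻¹ W) := by
  change (2 * _ : ℂ).re = (2 * _ : ℂ).re
  congr 2
  change star ((e : Mat2) *ᵥ p.1) ⬝ᵥ ((W : Mat2).adjugate *ᵥ ((e : Mat2) *ᵥ p.1))
      + star ((((conjT e)⁻¹ : SL2) : Mat2) *ᵥ p.2)
        ⬝ᵥ ((W : Mat2) *ᵥ ((((conjT e)⁻¹ : SL2) : Mat2) *ᵥ p.2))
    = star p.1 ⬝ᵥ ((((e⁻¹ : SL2) : Mat2) * (W : Mat2) * ((e⁻¹ : SL2) : Mat2)ᴴ).adjugate *ᵥ p.1)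
      + star p.2 ⬝ᵥ ((((e⁻¹ : SL2) : Mat2) * (W : Mat2) * ((e⁻¹ : SL2) : Mat2)ᴴ) *ᵥ p.2)
  -- The adjugate reverses products and inverts on `SL2`, so the `w`-term of `mu e⁻¹ W` becomes `e*
  -- Ŵ e`.
  have h : ((e⁻¹ : SL2) : Mat2).adjugate = (e : Mat2) := by
    rw [← Matrix.SpecialLinearGroup.coe_inv, inv_inv]
  rw [Matrix.mulVec_mulVec, Matrix.mulVec_mulVec, star_mulVec_dotProduct_mulVec,
    star_mulVec_dotProduct_mulVec, coe_inv_conjT, Matrix.conjTranspose_conjTranspose,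
    Matrix.adjugate_mul_distrib, Matrix.adjugate_mul_distrib, ← Matrix.adjugate_conjTranspose, h]
  simp only [mul_assoc]

theorem alphaForm_actPair (e : SL2) (p : C2 × C2) (ξ : sl2) :
    alphaForm (actPair e p) ξ = alphaForm p (adj (conjT e) ξ) := by
  change (2 * _ : ℂ).re = (2 * _ : ℂ).re
  congr 2
  change star ((e : Mat2) *ᵥ p.1) ⬝ᵥ ((ξ : Mat2) *ᵥ ((((conjT e)⁻¹ : SL2) : Mat2) *ᵥ p.2))
      + star ((((conjT e)⁻¹ : SL2) : Mat2) *ᵥ p.2) ⬝ᵥ ((ξ : Mat2)ᴴ *ᵥ ((e : Mat2) *ᵥ p.1))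
    = star p.1 ⬝ᵥ (((e : Mat2)ᴴ * (ξ : Mat2) * (((conjT e)⁻¹ : SL2) : Mat2)) *ᵥ p.2)
      + star p.2 ⬝ᵥ (((e : Mat2)ᴴ * (ξ : Mat2) * (((conjT e)⁻¹ : SL2) : Mat2))ᴴ *ᵥ p.1)
  rw [Matrix.mulVec_mulVec, Matrix.mulVec_mulVec, star_mulVec_dotProduct_mulVec,
    star_mulVec_dotProduct_mulVec]
  simp only [Matrix.conjTranspose_mul, Matrix.conjTranspose_conjTranspose, mul_assoc]

end HypSpin

end

/-! ### Assembly of the proposition -/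

theorem mainTheorem6 :
    -- the imaginary Killing spinors form the 4-dimensional complex span of the two families,
    -- parametrized linearly and bijectively by `w ⊕ u`
    HypSpin.IKS = (Submodule.span ℂ HypSpin.generators : Set (HypSpin.SL2 → HypSpin.Spinor)) ∧
    Module.finrank ℂ (Submodule.span ℂ HypSpin.generators) = 4 ∧
    (∃ Φ : (HypSpin.C2 × HypSpin.C2) ≃ₗ[ℂ] Submodule.span ℂ HypSpin.generators,
      ∀ p, (Φ p : HypSpin.SL2 → HypSpin.Spinor) = HypSpin.killingSpinor p) ∧
    (∀ p : HypSpin.C2 × HypSpin.C2,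
      -- `V_σ` is the restriction to the hyperboloid of the (real) form `V_{w⊕u}`, and a causal
      -- element of `N_b`
      (∀ g, HypSpin.normFun (HypSpin.killingSpinor p) g
        = HypSpin.VForm p ⟨HypSpin.basePoint g, HypSpin.basePoint_mem g⟩) ∧
      (∀ W : HypSpin.herm2, ((HypSpin.VForm p W : ℝ) : ℂ)
        = 2 * (star p.1 ⬝ᵥ ((W : HypSpin.Mat2).adjugate *ᵥ p.1)
          + star p.2 ⬝ᵥ ((W : HypSpin.Mat2) *ᵥ p.2))) ∧
      HypSpin.normFun (HypSpin.killingSpinor p) ∈ HypSpin.Nb ∧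
      HypSpin.IsCausal (HypSpin.normFun (HypSpin.killingSpinor p)) ∧
      -- `α_σ` is a real Killing 1-form, and `α_{w⊕u}` is the form on `𝔰𝔩₂(ℂ)` determined by it
      (∀ g ξ, ((HypSpin.current (HypSpin.killingSpinor p) g ξ : ℝ) : ℂ)
        = HypSpin.currentC (HypSpin.killingSpinor p) g ξ) ∧
      HypSpin.IsKillingForm (HypSpin.current (HypSpin.killingSpinor p)) ∧
      (∀ ξ : HypSpin.sl2, ((HypSpin.alphaForm p ξ : ℝ) : ℂ)
        = 2 * (star p.1 ⬝ᵥ ((ξ : HypSpin.Mat2) *ᵥ p.2)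
          + star p.2 ⬝ᵥ ((ξ : HypSpin.Mat2)ᴴ *ᵥ p.1))) ∧
      (∀ (g : HypSpin.SL2) (ξ : HypSpin.hermTraceless),
        HypSpin.current (HypSpin.killingSpinor p) g ((1 / 2 : ℝ) • ξ)
          = HypSpin.alphaForm p
              (HypSpin.adj (HypSpin.conjT g)⁻¹ (HypSpin.toSl2 ξ))) ∧
      (∀ η ξ : HypSpin.hermTraceless,
        ((HypSpin.formDeriv (HypSpin.current (HypSpin.killingSpinor p)) 1
            (HypSpin.toSl2 ((1 / 2 : ℝ) • η)) ((1 / 2 : ℝ) • ξ) : ℝ) : ℂ)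
          = star p.1 ⬝ᵥ (((ξ : HypSpin.Mat2) * (η : HypSpin.Mat2)
              - (η : HypSpin.Mat2) * (ξ : HypSpin.Mat2)) *ᵥ p.2)
            - star p.2 ⬝ᵥ (((ξ : HypSpin.Mat2) * (η : HypSpin.Mat2)
              - (η : HypSpin.Mat2) * (ξ : HypSpin.Mat2)) *ᵥ p.1)) ∧
      (∀ (η ξ : HypSpin.hermTraceless) (ζ : HypSpin.sl2),
        (ζ : HypSpin.Mat2) = (ξ : HypSpin.Mat2) * (η : HypSpin.Mat2)
          - (η : HypSpin.Mat2) * (ξ : HypSpin.Mat2) →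
        HypSpin.alphaForm p ζ
          = 2 * HypSpin.formDeriv (HypSpin.current (HypSpin.killingSpinor p)) 1
              (HypSpin.toSl2 ((1 / 2 : ℝ) • η)) ((1 / 2 : ℝ) • ξ))) ∧
    -- `SL(2,ℂ)`-equivariance
    (∀ (e : HypSpin.SL2) (p : HypSpin.C2 × HypSpin.C2),
      HypSpin.actField e (HypSpin.killingSpinor p)
        = HypSpin.killingSpinor (HypSpin.actPair e p) ∧
      ∀ (W : HypSpin.herm2) (ξ : HypSpin.sl2),
        HypSpin.killingMap (HypSpin.actPair e p) (W, ξ)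
          = HypSpin.killingMap p
              (HypSpin.mu e⁻¹ W, HypSpin.adj (HypSpin.conjT e) ξ)) := by
  refine ⟨HypSpin.IKS_eq_span, HypSpin.finrank_span_generators,
    ⟨HypSpin.killingSpinorEquiv, fun _ => rfl⟩, fun p => ⟨fun g => ?_, HypSpin.ofReal_VForm p,
      HypSpin.normFun_killingSpinor_mem_Nb p, HypSpin.isCausal_normFun_killingSpinor p,
      fun g ξ => ?_, HypSpin.isKillingForm_current_killingSpinor p,
      fun ξ => HypSpin.ofReal_alphaLin p ξ, HypSpin.current_killingSpinor_half p,
      HypSpin.ofReal_formDeriv_current_killingSpinor_one p, fun η ξ ζ hζ => ?_⟩,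
    fun e p => ⟨HypSpin.actField_killingSpinor e p, fun W ξ => ?_⟩⟩
  · exact HypSpin.normFun_killingSpinor p g
  · rw [HypSpin.current_killingSpinor, HypSpin.currentC_killingSpinor]
  · rw [HypSpin.formDeriv_current_killingSpinor_one, ← hζ]
    rfl
  · simp only [HypSpin.killingMap, LinearMap.coprod_apply, HypSpin.VForm_actPair,
      HypSpin.alphaForm_actPair]
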